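/- **Conventions.** A *band* is a commutative monoid $B$ with an absorbing element $0$, together with an ideal $N_B$ (the null set) of the semiring $B^+=\mathbb N[B]/(0_B\sim \text{empty sum})$ such that for every $a\in B$ there is a unique $b\in B$ with $a+b\in N_B$; band morphisms are the multiplicative maps that preserve $0$, $1$ and null sums. A commutative ring $R$ gives the band $\underline R=(R,\{\sum a_i: \sum a_i=0 \text{ in } R\})$. For a multiplicative submonoid $S\subseteq B$, the band $S^{-1}B$ is the monoid localization whose null set is the ideal generated by the sums $\sum \frac{a_i}{1}$ with $\sum a_i\in N_B$. The spectrum $\operatorname{Spec}B$ is the set of prime $m$-ideals of $B$ (subsets $\mathfrak p\ni 0$ with $B\mathfrak p\subseteq\mathfrak p$ whose complement contains $1$ and is multiplicatively closed), with the topology generated by the sets $U_h=\{\mathfrak p: h\notin\mathfrak p\}$ and the sheaf of bands with $\mathcal O(U_h)=B[h^{-1}]$ and stalks $B_{\mathfrak p}$. A *band scheme* is a topological space with a sheaf of bands that is locally isomorphic to spectra of bands; a morphism is a continuous map together with a morphism of sheaves of bands whose maps on stalks send non-units to non-units. Let $k$ be a field. A *$k$-band* is a band $B$ with a morphism $\underline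 k\to B$, and a *$k$-band scheme* is a band scheme with a morphism to $\operatorname{Spec}\underline k$. A *topological band* is a band with a topology for which multiplication is continuous. For a band scheme $X$ and a band $B$, let $X(B)=\operatorname{Hom}(\operatorname{Spec}B,X)$; if $B$ is a topological band, $X(B)$ carries the *fine topology*, the finest topology for which $\operatorname{Hom}(A,B)\to X(B)$, $f\mapsto \alpha\circ\operatorname{Spec}(f)$, is continuous for all bands $A$ and all morphisms $\alpha:\operatorname{Spec}A\to X$, where $\operatorname{Hom}(A,B)$ has the initial topology for the evaluations at the elements of $A$. If $X$ is a $k$-band scheme and $B$ is a $k$-band, let $X_k(B)\subseteq X(B)$ be the subset of morphisms over $\operatorname{Spec}\underline k$, with the subspace topology. **Theorem.** Let $k$ be a field, let $R$ be a finitely generated commutative $k$-algebra, and let $X=\operatorname{Spec}(\underline R)$. For a closed embedding $\iota:\operatorname{Spec}R\hookrightarrow\mathbb A^{n}_k$ over $k$ (for some $n\ge 0$), given by generators $a_1,\dots,a_n$ of the $k$-algebra $R$, let $R_\iota=\{c\,a_1^{e_1}\cdots a_n^{e_n}: c\in k,\ e_i\in\mathbb N\}\subseteq R$, a $k$-band with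 the null set induced from $\underline R$, and let $Y_\iota=\operatorname{Spec}(R_\iota)$. Consider the category whose objects are all such $\iota$ and whose morphisms from $\iota:\operatorname{Spec}R\hookrightarrow\mathbb A^n_k$ to $\jmath:\operatorname{Spec}R\hookrightarrow\mathbb A^m_k$ are the toric morphisms $\varphi:\mathbb A^n_k\to\mathbb A^m_k$ (those whose coordinates are monomials $x_1^{e_1}\cdots x_n^{e_n}$) with $\jmath=\varphi\circ\iota$; such a $\varphi$ gives an inclusion $R_\jmath\subseteq R_\iota$ and hence a morphism $Y_\iota\to Y_\jmath$. 1. The morphisms $X\to Y_\iota$ induced by the inclusions $R_\iota\subseteq\underline R$ make $X$ the limit of the diagram of the $Y_\iota$ in the category of band schemes: $$X\;\cong\;\lim_\iota Y_\iota .$$ 2. For every $k$-band $B$, the induced map $X_k(B)\to\lim_\iota (Y_\iota)_k(B)$ is a bijection, and for every topological $k$-band $B$ (a $k$-band that is a topological band) it is a homeomorphism, where the limit has the subspace topology of the product. 3. Likewise, for every band $B$ the induced map $X(B)\to\lim_\iota Y_\iota(B)$ is a bijection, and for every topological band $B$ it is a homeomorphism. -/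

import Mathlib

open CategoryTheory TopologicalSpace Opposite

universe u

/-! ### Bands -/

/-- A band: a pointed monoid `B` (a commutative monoid with an absorbing element `0`) with a null
set.  The ambient semiring `B⁺` is the semiring `ℕ[B]` of finite formal sums of elements of `B`
modulo `0_B ∼ (empty sum)`.  A finite formal sum `∑ aᵢ` is the multiset of its terms, so a subset
of `B⁺` is a set `null` of multisets with `0 ::ₘ s ∈ null ↔ s ∈ null`; it is an ideal of `B⁺` if
and only if it contains the empty sum and is closed under addition and under multiplication by
elements of `B`. -/
class Band (B : Type u) extends CommMonoidWithZero B where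
  /-- the null set -/
  null : Set (Multiset B)
  zero_cons_mem_null : ∀ s : Multiset B, 0 ::ₘ s ∈ null ↔ s ∈ null
  empty_mem_null : 0 ∈ null
  add_mem_null : ∀ s t : Multiset B, s ∈ null → t ∈ null → s + t ∈ null
  mul_mem_null : ∀ (b : B) (s : Multiset B), s ∈ null → s.map (fun a => b * a) ∈ null
  existsUnique_neg : ∀ a : B, ∃! b : B, ({a, b} : Multiset B) ∈ null

namespace Band

/-- The unique element `-a` such that `a + (-a)` is a null-sum. -/
noncomputable def neg {B : Type u} [Band B] (a : B) : B :=
  (existsUnique_neg a).choose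

theorem pair_neg_mem_null {B : Type u} [Band B] (a : B) : ({a, neg a} : Multiset B) ∈ null :=
  (existsUnique_neg a).choose_spec.1

theorem pair_mem_null_iff {B : Type u} [Band B] (a b : B) :
    ({a, b} : Multiset B) ∈ null ↔ b = neg a :=
  ⟨fun h => (existsUnique_neg a).choose_spec.2 b h, fun h => h ▸ pair_neg_mem_null a⟩

theorem neg_eq_mul {B : Type u} [Band B] (a : B) : neg a = neg 1 * a := by
  symm
  rw [← pair_mem_null_iff]
  simpa [mul_comm] using mul_mem_null a _ (pair_neg_mem_null (1 : B))

theorem neg_zero {B : Type u} [Band B] : neg (0 : B) = 0 := by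
  rw [neg_eq_mul, mul_zero]

/-- The underlying pointed monoid of a ring, with the formal sums whose value in the ring is zero
as null set. -/
abbrev ofCommRing (R : Type u) [CommRing R] : Band R where
  null := {s | s.sum = 0}
  zero_cons_mem_null s := by simp
  empty_mem_null := by simp
  add_mem_null s t hs ht := by
    simp only [Set.mem_ofPred_eq] at *
    simp [hs, ht]
  mul_mem_null b s hs := by
    simp only [Set.mem_ofPred_eq] at *
    rw [Multiset.sum_map_mul_left]
    simp [hs]
  existsUnique_neg a := by
    refine ⟨-a, by simp, fun b hb => ?_⟩
    simp only [Set.mem_ofPred_eq, Multiset.insert_eq_cons, Multiset.sum_cons,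
      Multiset.sum_singleton] at hb
    exact (neg_eq_of_add_eq_zero_right hb).symm

/-- The product of a family of bands: a finite formal sum is null if all its components are. -/
instance pi {I : Type u} (B : I → Type u) [∀ i, Band (B i)] : Band (∀ i, B i) where
  null := {s | ∀ i, s.map (fun a => a i) ∈ null}
  zero_cons_mem_null s := by simp [zero_cons_mem_null]
  empty_mem_null i := by simpa using empty_mem_null
  add_mem_null s t hs ht i := by
    rw [Multiset.map_add]
    exact add_mem_null _ _ (hs i) (ht i)
  mul_mem_null b s hs i := by
    have := mul_mem_null (b i) _ (hs i)
    rw [Multiset.map_map] at this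
    rw [Multiset.map_map]
    exact this
  existsUnique_neg a := by
    refine ⟨fun i => neg (a i), fun i => by simpa using pair_neg_mem_null (a i), fun b hb => ?_⟩
    funext i
    have := hb i
    rw [← pair_mem_null_iff]
    simpa using this

end Band

/-- A morphism of bands: a morphism of pointed monoids that sends null-sums to null-sums. -/
structure BandHom (A B : Type u) [Band A] [Band B] extends A →*₀ B where
  map_null : ∀ s : Multiset A, s ∈ Band.null → s.map toFun ∈ Band.null

namespace BandHom

instance {A B : Type u} [Band A] [Band B] : FunLike (BandHom A B) A B where
  coe f := f.toFun
  coe_injective f g h := by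
    obtain ⟨⟨⟨f, _⟩, _, _⟩, _⟩ := f
    obtain ⟨⟨⟨g, _⟩, _, _⟩, _⟩ := g
    cases h
    rfl

instance {A B : Type u} [Band A] [Band B] : MonoidWithZeroHomClass (BandHom A B) A B where
  map_mul f := f.map_mul'
  map_one f := f.map_one'
  map_zero f := f.map_zero'

theorem map_mem_null {A B : Type u} [Band A] [Band B] (f : BandHom A B) {s : Multiset A}
    (hs : s ∈ Band.null) : s.map f ∈ Band.null :=
  f.map_null s hs

@[ext]
theorem ext {A B : Type u} [Band A] [Band B] {f g : BandHom A B} (h : ∀ a, f a = g a) : f = g :=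
  DFunLike.ext f g h

/-- The identity of a band. -/
def id (A : Type u) [Band A] : BandHom A A where
  toMonoidWithZeroHom := MonoidWithZeroHom.id A
  map_null s hs := by
    have : s.map (fun a : A => a) ∈ Band.null := by simpa using hs
    exact this

/-- The composition of band morphisms. -/
def comp {A B C : Type u} [Band A] [Band B] [Band C] (g : BandHom B C) (f : BandHom A B) :
    BandHom A C where
  toMonoidWithZeroHom := g.toMonoidWithZeroHom.comp f.toMonoidWithZeroHom
  map_null s hs := by
    have := g.map_mem_null (f.map_mem_null hs)
    rw [Multiset.map_map] at this
    exact this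

@[simp]
theorem id_apply {A : Type u} [Band A] (a : A) : id A a = a := rfl

@[simp]
theorem comp_apply {A B C : Type u} [Band A] [Band B] [Band C] (g : BandHom B C)
    (f : BandHom A B) (a : A) : g.comp f a = g (f a) := rfl

theorem map_neg {A B : Type u} [Band A] [Band B] (f : BandHom A B) (a : A) :
    f (Band.neg a) = Band.neg (f a) := by
  rw [← Band.pair_mem_null_iff]
  simpa using f.map_mem_null (Band.pair_neg_mem_null a)

end BandHom

/-- The category of bands. -/
structure BandCat : Type (u + 1) where
  carrier : Type u
  [band : Band carrier]

namespace BandCat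

attribute [instance] BandCat.band

instance : CoeSort BandCat.{u} (Type u) := ⟨BandCat.carrier⟩

instance : Category BandCat.{u} where
  Hom A B := BandHom A B
  id A := BandHom.id A
  comp f g := BandHom.comp g f

instance : ConcreteCategory BandCat.{u} (fun A B => BandHom A B) where
  hom f := f
  ofHom f := f

/-- The bandification of a commutative ring. -/
def ofCommRing (R : Type u) [CommRing R] : BandCat.{u} :=
  letI := Band.ofCommRing R
  ⟨R⟩

end BandCat

/-- A subband of `B` with the null set induced from `B`. -/
structure SubBand (B : Type u) [Band B] extends Submonoid B where
  zero_mem' : 0 ∈ carrier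
  neg_mem' : ∀ a ∈ carrier, Band.neg a ∈ carrier

namespace SubBand

instance {B : Type u} [Band B] : SetLike (SubBand B) B where
  coe M := M.carrier
  coe_injective M N h := by
    obtain ⟨⟨⟨M, _⟩, _⟩, _, _⟩ := M
    obtain ⟨⟨⟨N, _⟩, _⟩, _, _⟩ := N
    cases h
    rfl

instance {B : Type u} [Band B] : SubmonoidClass (SubBand B) B where
  mul_mem {M} := M.toSubmonoid.mul_mem
  one_mem M := M.toSubmonoid.one_mem

instance {B : Type u} [Band B] (M : SubBand B) : Band M where
  toCommMonoid := SubmonoidClass.toCommMonoid M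
  zero := ⟨0, M.zero_mem'⟩
  zero_mul a := Subtype.ext (zero_mul a.1)
  mul_zero a := Subtype.ext (mul_zero a.1)
  null := {s | s.map Subtype.val ∈ Band.null}
  zero_cons_mem_null s := by
    rw [Set.mem_ofPred_eq, Multiset.map_cons]
    exact Band.zero_cons_mem_null _
  empty_mem_null := by
    rw [Set.mem_ofPred_eq, Multiset.map_zero]
    exact Band.empty_mem_null
  add_mem_null s t hs ht := by
    rw [Set.mem_ofPred_eq, Multiset.map_add]
    exact Band.add_mem_null _ _ hs ht
  mul_mem_null b s hs := by
    have := Band.mul_mem_null b.1 _ hs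
    rw [Multiset.map_map] at this
    rw [Set.mem_ofPred_eq, Multiset.map_map]
    exact this
  existsUnique_neg a := by
    refine ⟨⟨Band.neg a.1, M.neg_mem' _ a.2⟩, by simpa using Band.pair_neg_mem_null a.1,
      fun b hb => Subtype.ext ?_⟩
    rw [← Band.pair_mem_null_iff]
    simpa using hb

/-- The inclusion of a subband. -/
def subtype {B : Type u} [Band B] (M : SubBand B) : BandHom M B where
  toFun := Subtype.val
  map_zero' := rfl
  map_one' := rfl
  map_mul' _ _ := rfl
  map_null _ hs := hs

/-- The inclusion of a subband into a larger subband. -/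
def inclusion {B : Type u} [Band B] {M N : SubBand B} (h : ∀ a ∈ M, a ∈ N) : BandHom M N where
  toFun a := ⟨a.1, h _ a.2⟩
  map_zero' := rfl
  map_one' := rfl
  map_mul' _ _ := rfl
  map_null s hs := by
    change Multiset.map _ (Multiset.map _ s) ∈ Band.null
    rw [Multiset.map_map]
    exact hs

end SubBand

/-! ### Localizations -/

namespace Band

/-- The localization `S⁻¹B`.  Its null set is the ideal of `(S⁻¹B)⁺` generated by the sums
`∑ aᵢ/1` with `∑ aᵢ` in the null set of `B`; by passing to common denominators, this ideal
consists of the sums `∑ aᵢ/t` with `∑ aᵢ` in the null set of `B` and `t ∈ S`. -/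
instance localization {B : Type u} [Band B] (S : Submonoid B) : Band (Localization S) where
  null := {s | ∃ c ∈ (null : Set (Multiset B)), ∃ t : S, s = c.map fun a => Localization.mk a t}
  zero_cons_mem_null s := by
    constructor
    · rintro ⟨c, hc, t, h⟩
      obtain ⟨a, ha, h0⟩ := Multiset.mem_map.1 (h ▸ Multiset.mem_cons_self 0 s)
      obtain ⟨c, rfl⟩ := Multiset.exists_cons_of_mem ha
      rw [Multiset.map_cons, h0, Multiset.cons_inj_right] at h
      rw [← Localization.mk_zero 1, Localization.mk_eq_mk_iff, Localization.r_iff_exists] at h0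
      obtain ⟨u, hu⟩ := h0
      simp only [OneMemClass.coe_one, one_mul, mul_zero] at hu
      refine ⟨c.map fun b => (u : B) * b, ?_, u * t, ?_⟩
      · rw [← zero_cons_mem_null]
        simpa [hu] using mul_mem_null (u : B) _ hc
      · rw [h, Multiset.map_map]
        refine Multiset.map_congr rfl fun b _ => ?_
        rw [Function.comp_apply, Localization.mk_eq_mk_iff, Localization.r_iff_exists]
        exact ⟨1, by simp only [Submonoid.coe_mul]; grind⟩
    · rintro ⟨c, hc, t, rfl⟩
      refine ⟨0 ::ₘ c, (zero_cons_mem_null c).2 hc, t, ?_⟩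
      rw [Multiset.map_cons, Localization.mk_zero]
  empty_mem_null := ⟨0, empty_mem_null, 1, rfl⟩
  add_mem_null := by
    rintro _ _ ⟨c, hc, t, rfl⟩ ⟨d, hd, u, rfl⟩
    refine ⟨_, add_mem_null _ _ (mul_mem_null (u : B) _ hc) (mul_mem_null (t : B) _ hd), t * u, ?_⟩
    rw [Multiset.map_add, Multiset.map_map, Multiset.map_map]
    congr 1
    · refine Multiset.map_congr rfl fun b _ => ?_
      rw [Function.comp_apply, Localization.mk_eq_mk_iff, Localization.r_iff_exists]
      exact ⟨1, by simp only [Submonoid.coe_mul]; grind⟩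
    · refine Multiset.map_congr rfl fun b _ => ?_
      rw [Function.comp_apply, Localization.mk_eq_mk_iff, Localization.r_iff_exists]
      exact ⟨1, by simp only [Submonoid.coe_mul]; grind⟩
  mul_mem_null := by
    rintro x _ ⟨c, hc, t, rfl⟩
    induction x using Localization.induction_on with
    | H x =>
      refine ⟨_, mul_mem_null x.1 _ hc, x.2 * t, ?_⟩
      rw [Multiset.map_map, Multiset.map_map]
      refine Multiset.map_congr rfl fun b _ => ?_
      simp [Localization.mk_mul]
  existsUnique_neg x := by
    have key : ∀ (a : B) (t : S), Localization.mk (neg a) t =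
        Localization.mk (neg 1) (1 : S) * Localization.mk a t := by
      intro a t
      rw [Localization.mk_mul, one_mul, neg_eq_mul a]
    refine ⟨Localization.mk (neg 1) 1 * x, ?_, ?_⟩
    · induction x using Localization.induction_on with
      | H x =>
        refine ⟨_, pair_neg_mem_null x.1, x.2, ?_⟩
        rw [← key]
        rfl
    · rintro y ⟨c, hc, t, h⟩
      have hcard : c.card = 2 := by
        have := congrArg Multiset.card h
        simpa using this.symm
      obtain ⟨a, ha, hax⟩ : ∃ a ∈ c, Localization.mk a t = x :=
        Multiset.mem_map.1 (h ▸ by simp)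
      obtain ⟨c, rfl⟩ := Multiset.exists_cons_of_mem ha
      obtain ⟨b, rfl⟩ := Multiset.card_eq_one.1 (show c.card = 1 by simpa using hcard)
      have hb := (pair_mem_null_iff a b).1 hc
      rw [Multiset.map_cons, hax, Multiset.insert_eq_cons, Multiset.cons_inj_right,
        Multiset.map_singleton, Multiset.singleton_inj] at h
      rw [h, hb, key, hax]

theorem neg_mk {B : Type u} [Band B] (S : Submonoid B) (a : B) (t : S) :
    neg (Localization.mk a t) = Localization.mk (neg a) t := by
  symm
  rw [← pair_mem_null_iff]
  exact ⟨_, pair_neg_mem_null a, t, by simp⟩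

end Band

namespace BandHom

/-- The morphism `a / t ↦ f a / f t` between localizations. -/
noncomputable def localizationMap {A B : Type u} [Band A] [Band B] (f : BandHom A B)
    (S : Submonoid A) (T : Submonoid B) (h : ∀ a ∈ S, f a ∈ T) :
    BandHom (Localization S) (Localization T) where
  toFun x := x.liftOn (fun a t => Localization.mk (f a) ⟨f t, h t t.2⟩) (by
    intro a b t v hr
    rw [Localization.r_iff_exists] at hr
    obtain ⟨c, hc⟩ := hr
    rw [Localization.mk_eq_mk_iff, Localization.r_iff_exists]
    refine ⟨⟨f c, h c c.2⟩, ?_⟩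
    have := congrArg f hc
    simpa only [map_mul] using this)
  map_zero' := by
    rw [Localization.liftOn_zero, map_zero, Localization.mk_zero]
  map_one' := by
    rw [← Localization.mk_one, Localization.liftOn_mk, ← Localization.mk_one,
      Localization.mk_eq_mk_iff, Localization.r_iff_exists]
    exact ⟨1, by simp⟩
  map_mul' x y := by
    induction x using Localization.induction_on with
    | H x =>
      induction y using Localization.induction_on with
      | H y =>
        rw [Localization.mk_mul, Localization.liftOn_mk, Localization.liftOn_mk,
          Localization.liftOn_mk, Localization.mk_mul, map_mul]
        congr 1
        exact Subtype.ext (map_mul f _ _)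
  map_null := by
    rintro _ ⟨c, hc, t, rfl⟩
    refine ⟨_, f.map_mem_null hc, ⟨f t, h t t.2⟩, ?_⟩
    rw [Multiset.map_map, Multiset.map_map]
    rfl

theorem localizationMap_mk {A B : Type u} [Band A] [Band B] (f : BandHom A B)
    (S : Submonoid A) (T : Submonoid B) (h : ∀ a ∈ S, f a ∈ T) (a : A) (t : S) :
    f.localizationMap S T h (Localization.mk a t) = Localization.mk (f a) ⟨f t, h t t.2⟩ :=
  rfl

end BandHom

/-! ### The spectrum of a band -/

/-- A prime m-ideal of a band: a subset that contains `0`, absorbs multiplication, and whose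
complement contains `1` and is closed under multiplication. -/
@[ext]
structure BandSpec (B : Type u) [Band B] : Type u where
  carrier : Set B
  zero_mem : 0 ∈ carrier
  mul_mem : ∀ b a : B, a ∈ carrier → b * a ∈ carrier
  one_notMem : 1 ∉ carrier
  mem_or_mem : ∀ a b : B, a * b ∈ carrier → a ∈ carrier ∨ b ∈ carrier

namespace BandSpec

/-- The complement of a prime m-ideal. -/
def compl {B : Type u} [Band B] (p : BandSpec B) : Submonoid B where
  carrier := p.carrierᶜ
  one_mem' := p.one_notMem
  mul_mem' ha hb hab := (p.mem_or_mem _ _ hab).elim ha hb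

/-- The principal open subset `U_h`. -/
def basicOpen {B : Type u} [Band B] (h : B) : Set (BandSpec B) := {p | h ∉ p.carrier}

/-- The topology generated by the principal open subsets. -/
instance {B : Type u} [Band B] : TopologicalSpace (BandSpec B) :=
  TopologicalSpace.generateFrom (Set.range basicOpen)

theorem isOpen_basicOpen {B : Type u} [Band B] (h : B) : IsOpen (basicOpen h) :=
  TopologicalSpace.isOpen_generateFrom_of_mem ⟨h, rfl⟩

/-- The stalk `B_𝔭`. -/
abbrev Stalk {B : Type u} [Band B] (p : BandSpec B) : Type u := Localization p.compl

/-- The map on spectra induced by a morphism of bands. -/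
def comap {A B : Type u} [Band A] [Band B] (f : BandHom A B) (q : BandSpec B) : BandSpec A where
  carrier := f ⁻¹' q.carrier
  zero_mem := by simpa using q.zero_mem
  mul_mem b a ha := by simpa using q.mul_mem (f b) (f a) ha
  one_notMem := by simpa using q.one_notMem
  mem_or_mem a b hab := q.mem_or_mem (f a) (f b) (by simpa using hab)

theorem continuous_comap {A B : Type u} [Band A] [Band B] (f : BandHom A B) :
    Continuous (comap f) := by
  refine continuous_generateFrom_iff.2 ?_
  rintro _ ⟨h, rfl⟩
  exact isOpen_basicOpen (f h)

/-- The morphism `A_{f⁻¹(𝔮)} → B_𝔮` induced by `f : A → B`. -/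
noncomputable def stalkMap {A B : Type u} [Band A] [Band B] (f : BandHom A B) (q : BandSpec B) :
    BandHom (comap f q).Stalk q.Stalk :=
  f.localizationMap (comap f q).compl q.compl fun _ ha => ha

/-- A family of elements of the stalks is locally a fraction. -/
def IsLocallyFraction {B : Type u} [Band B] {U : Set (BandSpec B)}
    (s : ∀ p : U, p.1.Stalk) : Prop :=
  ∀ p : U, ∃ a h : B, h ∉ p.1.carrier ∧ ∃ V : Set (BandSpec B), IsOpen V ∧ p.1 ∈ V ∧
    ∀ q : U, q.1 ∈ V → ∃ hq : h ∈ q.1.compl, s q = Localization.mk a ⟨h, hq⟩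

/-- The band `𝒪(U)` of sections of the structure sheaf over `U`: the families of elements of the
stalks `B_𝔭`, `𝔭 ∈ U`, that are locally of the form `a / h`.  A formal sum of sections is null if
it is null in every stalk.  Every non-empty principal open `U_h` has a unique closed point, whose
only neighbourhood in `U_h` is `U_h` and whose stalk is `B[h⁻¹]`; so this is the sheaf with
`𝒪(U_h) = B[h⁻¹]`. -/
noncomputable def sections {B : Type u} [Band B] (U : Set (BandSpec B)) :
    SubBand (∀ p : U, p.1.Stalk) where
  carrier := {s | IsLocallyFraction s}
  one_mem' p := ⟨1, 1, p.1.one_notMem, Set.univ, isOpen_univ, trivial, fun q _ =>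
    ⟨q.1.one_notMem, Localization.mk_one.symm⟩⟩
  zero_mem' p := ⟨0, 1, p.1.one_notMem, Set.univ, isOpen_univ, trivial, fun q _ =>
    ⟨q.1.one_notMem, (Localization.mk_zero _).symm⟩⟩
  mul_mem' := by
    intro s t hs ht p
    obtain ⟨a, h, hp, V, hV, hpV, H⟩ := hs p
    obtain ⟨b, g, gp, W, hW, hpW, G⟩ := ht p
    refine ⟨a * b, h * g, p.1.compl.mul_mem hp gp, V ∩ W, hV.inter hW, ⟨hpV, hpW⟩,
      fun q hq => ?_⟩
    obtain ⟨h1, e1⟩ := H q hq.1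
    obtain ⟨h2, e2⟩ := G q hq.2
    refine ⟨q.1.compl.mul_mem h1 h2, ?_⟩
    rw [Pi.mul_apply, e1, e2, Localization.mk_mul]
    rfl
  neg_mem' := by
    intro s hs p
    obtain ⟨a, h, hp, V, hV, hpV, H⟩ := hs p
    refine ⟨Band.neg a, h, hp, V, hV, hpV, fun q hq => ?_⟩
    obtain ⟨h1, e1⟩ := H q hq
    refine ⟨h1, ?_⟩
    rw [← Band.neg_mk, ← e1, ← Band.pair_mem_null_iff]
    simpa using Band.pair_neg_mem_null s q

end BandSpec

namespace BandSpec

/-- Restriction of sections of the structure sheaf. -/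
noncomputable def restrict {B : Type u} [Band B] {U V : Set (BandSpec B)} (h : V ⊆ U) :
    BandHom (sections U) (sections V) where
  toFun s := ⟨fun p => s.1 ⟨p.1, h p.2⟩, fun p => by
    obtain ⟨a, g, hg, W, hW, hpW, H⟩ := s.2 ⟨p.1, h p.2⟩
    exact ⟨a, g, hg, W, hW, hpW, fun q hq => H ⟨q.1, h q.2⟩ hq⟩⟩
  map_zero' := rfl
  map_one' := rfl
  map_mul' _ _ := rfl
  map_null m hm p := by
    have := hm ⟨p.1, h p.2⟩
    rw [Multiset.map_map] at this
    rw [Multiset.map_map, Multiset.map_map]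
    exact this

theorem stalkMap_id {B : Type u} [Band B] (p : BandSpec B) (x : p.Stalk) :
    stalkMap (BandHom.id B) p x = x := by
  induction x using Localization.induction_on with
  | H x => rfl

theorem stalkMap_comp {A B C : Type u} [Band A] [Band B] [Band C] (f : BandHom A B)
    (g : BandHom B C) (p : BandSpec C) (x : (comap f (comap g p)).Stalk) :
    stalkMap (g.comp f) p x = stalkMap g p (stalkMap f (comap g p) x) := by
  induction x using Localization.induction_on with
  | H x => rfl

/-- Pullback of sections along `Spec C → Spec B`: on stalks it is given by `B_{f⁻¹(𝔮)} → C_𝔮`. -/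
noncomputable def pullback {B C : Type u} [Band B] [Band C] (f : BandHom B C)
    (U : Set (BandSpec B)) : BandHom (sections U) (sections (comap f ⁻¹' U)) where
  toFun s := ⟨fun q => stalkMap f q.1 (s.1 ⟨comap f q.1, q.2⟩), fun q => by
    obtain ⟨a, g, hg, W, hW, hpW, H⟩ := s.2 ⟨comap f q.1, q.2⟩
    refine ⟨f a, f g, hg, comap f ⁻¹' W, hW.preimage (continuous_comap f), hpW, fun r hr => ?_⟩
    obtain ⟨h1, e1⟩ := H ⟨comap f r.1, r.2⟩ hr
    exact ⟨h1, congrArg (stalkMap f r.1) e1⟩⟩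
  map_zero' := Subtype.ext (funext fun q => map_zero (stalkMap f q.1))
  map_one' := Subtype.ext (funext fun q => map_one (stalkMap f q.1))
  map_mul' s t := Subtype.ext (funext fun q => map_mul (stalkMap f q.1) _ _)
  map_null m hm q := by
    have := (stalkMap f q.1).map_mem_null (hm ⟨comap f q.1, q.2⟩)
    rw [Multiset.map_map, Multiset.map_map] at this
    rw [Multiset.map_map, Multiset.map_map]
    exact this

theorem notMem_of_isUnit {B : Type u} [Band B] {p : BandSpec B} {a : B} {t : p.compl}
    (h : IsUnit (Localization.mk a t)) : a ∉ p.carrier := by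
  intro ha
  obtain ⟨y, hy⟩ := h.exists_right_inv
  induction y using Localization.induction_on with
  | H y =>
    rw [Localization.mk_mul, ← Localization.mk_one, Localization.mk_eq_mk_iff,
      Localization.r_iff_exists] at hy
    obtain ⟨c, hc⟩ := hy
    have h1 : (c * (t * y.2) : p.compl).1 ∈ p.carrier := by
      have := p.mul_mem (c * y.1) a ha
      have e : (c * (t * y.2) : p.compl).1 = c * y.1 * a := by
        simpa [mul_assoc, mul_comm a] using hc.symm
      rwa [e]
    exact (c * (t * y.2) : p.compl).2 h1

theorem isUnit_mk {B : Type u} [Band B] {p : BandSpec B} {a h : B} (ha : a ∈ p.compl)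
    (hh : h ∈ p.compl) :
    (Localization.mk a ⟨h, hh⟩ : p.Stalk) * Localization.mk h ⟨a, ha⟩ = 1 := by
  rw [Localization.mk_mul, ← Localization.mk_one, Localization.mk_eq_mk_iff,
      Localization.r_iff_exists]
  exact ⟨1, by simp [mul_comm]⟩

theorem isUnit_of_forall {B : Type u} [Band B] {U : Set (BandSpec B)} (s : sections U)
    (h : ∀ p, IsUnit (s.1 p)) : IsUnit s := by
  choose t ht using fun p => (h p).exists_right_inv
  refine IsUnit.of_mul_eq_one ⟨t, fun p => ?_⟩ (Subtype.ext (funext ht))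
  obtain ⟨a, g, hg, W, hW, hpW, H⟩ := s.2 p
  have ha : a ∉ p.1.carrier := by
    obtain ⟨_, e⟩ := H p hpW
    exact notMem_of_isUnit (e ▸ h p)
  refine ⟨g, a, ha, W ∩ basicOpen a, hW.inter (isOpen_basicOpen a), ⟨hpW, ha⟩, fun q hq => ?_⟩
  obtain ⟨h1, e1⟩ := H q hq.1
  refine ⟨hq.2, ?_⟩
  have e2 := isUnit_mk (p := q.1) hq.2 h1
  rw [← e1] at e2
  exact (h q).mul_left_cancel ((ht q).trans e2.symm)

/-- The structure sheaf as a presheaf. -/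
noncomputable def structurePresheaf (B : Type u) [Band B] :
    TopCat.Presheaf BandCat.{u} (TopCat.of (BandSpec B)) where
  obj U := ⟨sections (U.unop : Set (BandSpec B))⟩
  map i := restrict (leOfHom i.unop)
  map_id _ := rfl
  map_comp _ _ := rfl

theorem isSheaf_structurePresheaf (B : Type u) [Band B] : (structurePresheaf B).IsSheaf := by
  intro E
  rw [← isSheaf_iff_isSheaf_of_type]
  refine TopCat.Presheaf.isSheaf_of_isSheafUniqueGluing_types
    (X := TopCat.of (BandSpec B)) (structurePresheaf B ⋙ coyoneda.obj (op E)) ?_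
  intro I U sf hsf
  let g : ∀ i, BandHom E (sections (U i : Set (BandSpec B))) := sf
  have key : ∀ (i j : I) (e : E) (p : BandSpec B) (hi : p ∈ U i) (hj : p ∈ U j),
      (g i e).1 ⟨p, hi⟩ =
        (g j e).1 ⟨p, hj⟩ := by
    intro i j e p hi hj
    have h1 : BandHom.comp (restrict (inf_le_left : U i ⊓ U j ≤ U i)) (g i) =
      BandHom.comp (restrict (inf_le_right : U i ⊓ U j ≤ U j)) (g j) := hsf i j
    have h2 := DFunLike.congr_fun h1 e
    exact congrFun (congrArg Subtype.val h2) ⟨p, hi, hj⟩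
  have mem : ∀ p : ((iSup U : Opens (TopCat.of (BandSpec B))) : Set (BandSpec B)),
      ∃ i, p.1 ∈ U i := fun p => Opens.mem_iSup.1 p.2
  choose ix hix using mem
  let s : BandHom E (sections ((iSup U : Opens (TopCat.of (BandSpec B))) : Set (BandSpec B))) :=
    { toFun := fun e => ⟨fun p => (g (ix p) e).1 ⟨p.1, hix p⟩, fun p => by
          obtain ⟨a, h, hh, W, hW, hpW, H⟩ := (g (ix p) e).2 ⟨p.1, hix p⟩
          refine ⟨a, h, hh, W ∩ U (ix p), hW.inter (U (ix p)).2, ⟨hpW, hix p⟩, fun q hq => ?_⟩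
          obtain ⟨h1, e1⟩ := H ⟨q.1, hq.2⟩ hq.1
          exact ⟨h1, by rw [← e1]; exact key _ _ _ _ _ _⟩⟩
      map_zero' := Subtype.ext (funext fun p => by
        change (g (ix p) 0).1 _ = 0
        rw [map_zero]; rfl)
      map_one' := Subtype.ext (funext fun p => by
        change (g (ix p) 1).1 _ = 1
        rw [map_one]; rfl)
      map_mul' := fun a b => Subtype.ext (funext fun p => by
        change (g (ix p) (a * b)).1 _ = _
        rw [map_mul]; rfl)
      map_null := fun m hm p => by
        have := (g (ix p)).map_mem_null hm ⟨p.1, hix p⟩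
        rw [Multiset.map_map, Multiset.map_map] at this
        rw [Multiset.map_map, Multiset.map_map]
        exact this }
  refine ⟨s, fun i => ?_, fun t ht => ?_⟩
  · refine BandHom.ext (fun e => Subtype.ext (funext fun p => ?_))
    exact key _ _ _ _ _ _
  · refine BandHom.ext (fun e => Subtype.ext (funext fun p => ?_))
    have h1 : BandHom.comp (restrict (Opens.leSupr U (ix p)).le) t = g (ix p) := ht (ix p)
    have h2 := DFunLike.congr_fun h1 e
    exact congrFun (congrArg Subtype.val h2) ⟨p.1, hix p⟩

end BandSpec

/-! ### Band schemes -/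

open AlgebraicGeometry

/-- A topological space with a sheaf of bands. -/
abbrev BandSpace : Type (u + 1) := SheafedSpace.{u + 1, u, u} BandCat.{u}

/-- The spectrum of a band as a topological space with a sheaf of bands. -/
noncomputable def BandCat.specSpace (B : BandCat.{u}) : BandSpace.{u} where
  carrier := TopCat.of (BandSpec B)
  presheaf := BandSpec.structurePresheaf B
  IsSheaf := BandSpec.isSheaf_structurePresheaf B

namespace BandSpace

/-- A section `s` of a sheaf of bands over `U` is invertible at `x` if it is invertible in some
neighbourhood of `x` in `U`, equivalently, if its germ is a unit of the stalk at `x`. -/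
def IsUnitAt (X : BandSpace.{u}) {U : Opens X} (s : X.presheaf.obj (op U)) (x : X) : Prop :=
  ∃ (V : Opens X) (i : V ≤ U), x ∈ V ∧ IsUnit (X.presheaf.map (homOfLE i).op s)

/-- A morphism `f : X → Y` is local if the maps on stalks `𝒪_{Y,f(x)} → 𝒪_{X,x}` map non-units to
non-units. -/
def IsLocal {X Y : BandSpace.{u}} (f : X ⟶ Y) : Prop :=
  ∀ (U : Opens Y) (s : Y.presheaf.obj (op U)) (x : X), f.hom.base x ∈ U →
    IsUnitAt X (U := (Opens.map f.hom.base).obj U) (f.hom.c.app (op U) s) x →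
      IsUnitAt Y s (f.hom.base x)

theorem isLocal_id (X : BandSpace.{u}) : IsLocal (𝟙 X) := by
  intro U s x _ h
  exact h

theorem isLocal_comp {X Y Z : BandSpace.{u}} {f : X ⟶ Y} {g : Y ⟶ Z}
    (hf : IsLocal f) (hg : IsLocal g) : IsLocal (f ≫ g) := by
  intro U s x hx h
  exact hg U s _ hx (hf _ _ x hx h)

end BandSpace

/-- A band scheme: a topological space with a sheaf of bands such that every point has an open
neighbourhood that is isomorphic to the spectrum of a band. -/
structure BandScheme : Type (u + 1) where
  toBandSpace : BandSpace.{u}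
  local_affine : ∀ x : toBandSpace, ∃ (U : OpenNhds x) (B : BandCat.{u}),
    Nonempty (SheafedSpace.restrict toBandSpace U.isOpenEmbedding ≅ B.specSpace)

namespace BandScheme

/-- A morphism of band schemes: a local morphism of topological spaces with a sheaf of bands. -/
@[ext]
structure Hom (X Y : BandScheme.{u}) : Type u where
  hom : X.toBandSpace ⟶ Y.toBandSpace
  isLocal : BandSpace.IsLocal hom

instance : Category BandScheme.{u} where
  Hom := Hom
  id X := ⟨𝟙 _, BandSpace.isLocal_id _⟩
  comp f g := ⟨f.hom ≫ g.hom, BandSpace.isLocal_comp f.isLocal g.isLocal⟩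

/-- The affine band scheme `Spec B`. -/
noncomputable def specObj (B : BandCat.{u}) : BandScheme.{u} where
  toBandSpace := B.specSpace
  local_affine _ := ⟨⊤, B, ⟨SheafedSpace.restrictTopIso B.specSpace⟩⟩

/-- The morphism of band schemes induced by a morphism of bands. -/
noncomputable def specMap {A B : BandCat.{u}} (f : A ⟶ B) : specObj B ⟶ specObj A where
  hom :=
    { hom :=
      { base := TopCat.ofHom ⟨BandSpec.comap f, BandSpec.continuous_comap f⟩
        c :=
        { app := fun U =>
            BandSpec.pullback f (SetLike.coe (U.unop : Opens (TopCat.of (BandSpec A))))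
          naturality := fun _ _ _ => rfl } } }
  isLocal := by
    intro U s q hq ⟨V, i, hqV, hV⟩
    have h1 : IsUnit (BandSpec.stalkMap f q (s.1 ⟨BandSpec.comap f q, hq⟩)) := by
      obtain ⟨t, ht⟩ := hV.exists_right_inv
      exact IsUnit.of_mul_eq_one _ (congrFun (congrArg Subtype.val ht) ⟨q, hqV⟩)
    obtain ⟨a, g, hg, W, hW, hpW, H⟩ := s.2 ⟨BandSpec.comap f q, hq⟩
    have ha : a ∉ (BandSpec.comap f q).carrier := by
      obtain ⟨_, e⟩ := H _ hpW
      rw [e] at h1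
      exact BandSpec.notMem_of_isUnit (p := q) h1
    refine ⟨U ⊓ ⟨W ∩ BandSpec.basicOpen a, hW.inter (BandSpec.isOpen_basicOpen a)⟩,
      inf_le_left, ⟨hq, hpW, ha⟩, BandSpec.isUnit_of_forall _ fun p => ?_⟩
    obtain ⟨h2, e2⟩ := H ⟨p.1, p.2.1⟩ p.2.2.1
    exact IsUnit.of_mul_eq_one _
      ((congrArg (· * _) e2).trans (BandSpec.isUnit_mk (p := p.1) p.2.2.2 h2))

theorem specMap_id (B : BandCat.{u}) : specMap (𝟙 B) = 𝟙 (specObj B) := by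
  apply Hom.ext
  apply InducedCategory.hom_ext
  refine PresheafedSpace.hext _ _ rfl (heq_of_eq ?_)
  ext U s
  refine Subtype.ext (funext fun p => ?_)
  exact BandSpec.stalkMap_id p.1 (s.1 p)

theorem specMap_comp {A B C : BandCat.{u}} (f : A ⟶ B) (g : B ⟶ C) :
    specMap (f ≫ g) = specMap g ≫ specMap f := by
  apply Hom.ext
  apply InducedCategory.hom_ext
  refine PresheafedSpace.hext _ _ rfl (heq_of_eq ?_)
  ext U s
  refine Subtype.ext (funext fun p => ?_)
  exact BandSpec.stalkMap_comp f g p.1 (s.1 ⟨_, p.2⟩)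

/-- The functor `Spec`. -/
noncomputable def spec : BandCat.{u}ᵒᵖ ⥤ BandScheme.{u} where
  obj B := specObj B.unop
  map f := specMap f.unop
  map_id B := specMap_id B.unop
  map_comp f g := specMap_comp g.unop f.unop

end BandScheme

/-! ### Points and the fine topology -/

namespace BandCat

/-- The affine topology on `Hom(A, B)` for a topological band `B`: the initial topology for the
evaluations `f ↦ f a` at the elements `a` of `A`. -/
abbrev affineTopology (A B : BandCat.{u}) [TopologicalSpace B] : TopologicalSpace (A ⟶ B) :=
  ⨅ a : A, TopologicalSpace.induced (fun f : A ⟶ B => f a) inferInstance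

end BandCat

namespace BandScheme

/-- The set `X(B) = Hom(Spec B, X)` of `B`-rational points. -/
def Points (X : BandScheme.{u}) (B : BandCat.{u}) : Type u := spec.obj (op B) ⟶ X

/-- The fine topology on `X(B)` for a topological band `B`: the finest topology such that, for every
affine band scheme `Y = Spec A` and every morphism `α : Y → X`, the map `α_B : Y(B) → X(B)` is
continuous for the affine topology on `Y(B) = Hom(A, B)`. -/
noncomputable instance fineTopology (X : BandScheme.{u}) (B : BandCat.{u}) [TopologicalSpace B] :
    TopologicalSpace (X.Points B) :=
  ⨆ (A : BandCat.{u}) (α : spec.obj (op A) ⟶ X),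
    TopologicalSpace.coinduced (fun f : A ⟶ B => (spec.map f.op ≫ α : X.Points B))
      (BandCat.affineTopology A B)

end BandScheme

/-! ### Band schemes over a field -/

/-- A `k`-band: a band `B` with a morphism from the bandification of `k` to `B`. -/
abbrev KBand (k : Type u) [Field k] : Type (u + 1) := Under (BandCat.ofCommRing k)

/-- A `k`-band scheme: a band scheme `X` with a morphism from `X` to the spectrum of the
bandification of `k`. -/
abbrev KBandScheme (k : Type u) [Field k] : Type (u + 1) :=
  Over (BandScheme.spec.obj (op (BandCat.ofCommRing k)))

/-- The spectrum of a `k`-band. -/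
noncomputable def KBand.spec {k : Type u} [Field k] (B : KBand k) : KBandScheme k :=
  Over.mk (BandScheme.spec.map B.hom.op)

/-- The morphism of `k`-band schemes induced by a morphism of `k`-bands. -/
noncomputable def KBand.specMap {k : Type u} [Field k] {A B : KBand k} (f : A ⟶ B) :
    B.spec ⟶ A.spec :=
  Over.homMk (BandScheme.spec.map f.right.op) (by
    change BandScheme.spec.map _ ≫ BandScheme.spec.map _ = BandScheme.spec.map _
    rw [← Functor.map_comp, ← op_comp, Under.w])

namespace KBandScheme

/-- The set of `B`-rational points of a `k`-band scheme `X` for a `k`-band `B`: the morphisms of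
`k`-band schemes from `Spec B` to `X`. -/
def Points {k : Type u} [Field k] (X : KBandScheme k) (B : KBand k) : Type u := B.spec ⟶ X

/-- The fine topology on the `B`-rational points of a `k`-band scheme, as a subset of the set of all
morphisms of band schemes from `Spec B` to `X`. -/
noncomputable instance fineTopology {k : Type u} [Field k] (X : KBandScheme k) (B : KBand k)
    [TopologicalSpace B.right] : TopologicalSpace (X.Points B) :=
  TopologicalSpace.induced (fun f : B.spec ⟶ X => (f.left : BandScheme.Points X.left B.right))
    (BandScheme.fineTopology X.left B.right)

end KBandScheme

/-! ### Closed embeddings into affine spaces and monomial models -/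

/-- A closed embedding `ι : Spec R ↪ 𝔸ⁿ_k` over `k`, that is, a surjective homomorphism of
`k`-algebras from the coordinate ring `k[x₁, …, xₙ]` of `𝔸ⁿ_k` to `R`, or equivalently a choice of
generators `a₁, …, aₙ` of `R`. -/
structure AffineEmbedding (k R : Type u) [Field k] [CommRing R] [Algebra k R] : Type u where
  n : ℕ
  pullback : MvPolynomial (Fin n) k →ₐ[k] R
  surjective : Function.Surjective pullback

/-- The pullback of coordinate rings `k[y₁, …, yₘ] → k[x₁, …, xₙ]` of a morphism
`φ : 𝔸ⁿ_k → 𝔸ᵐ_k` over `k`.  It belongs to a toric morphism, i.e. `φ` restricts to a homomorphism of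
the tori `𝔾ₘⁿ → 𝔾ₘᵐ`, if and only if it maps every coordinate `yⱼ` to a monomial
`x₁^{e₁} ⋯ xₙ^{eₙ}`. -/
def IsToric {k : Type u} [Field k] {m n : ℕ}
    (φ : MvPolynomial (Fin m) k →ₐ[k] MvPolynomial (Fin n) k) : Prop :=
  ∀ j : Fin m, ∃ e : Fin n →₀ ℕ, φ (MvPolynomial.X j) = MvPolynomial.monomial e 1

theorem IsToric.exists_monomial {k : Type u} [Field k] {m n : ℕ}
    {φ : MvPolynomial (Fin m) k →ₐ[k] MvPolynomial (Fin n) k} (h : IsToric φ) (d : Fin m →₀ ℕ)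
    (c : k) : ∃ e : Fin n →₀ ℕ, φ (MvPolynomial.monomial d c) = MvPolynomial.monomial e c := by
  choose e he using h
  refine ⟨d.sum fun j r => r • e j, ?_⟩
  rw [MvPolynomial.monomial_eq, map_mul, Finsupp.prod, map_prod, MvPolynomial.algHom_C]
  simp_rw [map_pow, he, MvPolynomial.monomial_pow, one_pow]
  rw [← MvPolynomial.monomial_sum_one, MvPolynomial.algebraMap_eq, MvPolynomial.C_mul_monomial,
    mul_one]
  rfl

namespace AffineEmbedding

/-- A morphism from `ι : X ↪ 𝔸ⁿ_k` to `j : X ↪ 𝔸ᵐ_k`: a toric morphism `φ : 𝔸ⁿ_k → 𝔸ᵐ_k` such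
that `j = φ ∘ ι`. -/
@[ext]
structure Hom {k R : Type u} [Field k] [CommRing R] [Algebra k R] (ι j : AffineEmbedding k R) :
    Type u where
  pullback : MvPolynomial (Fin j.n) k →ₐ[k] MvPolynomial (Fin ι.n) k
  isToric : IsToric pullback
  comp_eq : ι.pullback.comp pullback = j.pullback

noncomputable instance {k R : Type u} [Field k] [CommRing R] [Algebra k R] :
    Category (AffineEmbedding k R) where
  Hom := Hom
  id ι := ⟨AlgHom.id k _, fun j => ⟨Finsupp.single j 1, rfl⟩, rfl⟩
  comp φ ψ := ⟨φ.pullback.comp ψ.pullback, fun j => by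
    obtain ⟨e, he⟩ := ψ.isToric j
    obtain ⟨d, hd⟩ := φ.isToric.exists_monomial e 1
    exact ⟨d, by rw [AlgHom.comp_apply, he, hd]⟩, by
    rw [← AlgHom.comp_assoc, φ.comp_eq, ψ.comp_eq]⟩

/-- The underlying band of the monomial band model `R_ι`: the subset
`{c a₁^{e₁} ⋯ aₙ^{eₙ} | c ∈ k, eᵢ ∈ ℕ}` of `R`, where `aᵢ` is the image of the coordinate `xᵢ`, with
the null set induced from the bandification of `R`. -/
def model {k R : Type u} [Field k] [CommRing R] [Algebra k R] (ι : AffineEmbedding k R) :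
    letI := Band.ofCommRing R
    SubBand R :=
  letI := Band.ofCommRing R
  { carrier := {r | ∃ (c : k) (e : Fin ι.n → ℕ),
      r = algebraMap k R c * ∏ i, ι.pullback (MvPolynomial.X i) ^ e i}
    one_mem' := ⟨1, 0, by simp⟩
    mul_mem' := by
      rintro _ _ ⟨c, e, rfl⟩ ⟨d, f, rfl⟩
      refine ⟨c * d, e + f, ?_⟩
      simp only [map_mul, Pi.add_apply, pow_add, Finset.prod_mul_distrib]
      ring
    zero_mem' := ⟨0, 0, by simp⟩
    neg_mem' := by
      rintro _ ⟨c, e, rfl⟩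
      refine ⟨-c, e, ?_⟩
      symm
      rw [← Band.pair_mem_null_iff]
      simp [Band.null] }

theorem algebraMap_mem_model {k R : Type u} [Field k] [CommRing R] [Algebra k R]
    (ι : AffineEmbedding k R) (c : k) : algebraMap k R c ∈ ι.model :=
  ⟨c, 0, by simp⟩

/-- A toric morphism `φ` with `j = φ ∘ ι` gives the inclusion `R_j ⊆ R_ι`. -/
theorem model_le_of_hom {k R : Type u} [Field k] [CommRing R] [Algebra k R]
    {ι j : AffineEmbedding k R} (φ : ι ⟶ j) : ∀ r ∈ j.model, r ∈ ι.model := by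
  rintro _ ⟨c, d, rfl⟩
  obtain ⟨e, he⟩ := φ.isToric.exists_monomial (Finsupp.equivFunOnFinite.symm d) c
  refine ⟨c, e, ?_⟩
  have h := congrArg ι.pullback he
  rw [← AlgHom.comp_apply, φ.comp_eq] at h
  simpa [MvPolynomial.monomial_eq, Finsupp.prod_fintype, MvPolynomial.algHom_C] using h

end AffineEmbedding

/-- The morphism between bandifications induced by a ring homomorphism. -/
def BandCat.ofRingHom {R S : Type u} [CommRing R] [CommRing S] (f : R →+* S) :
    BandCat.ofCommRing R ⟶ BandCat.ofCommRing S :=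
  letI := Band.ofCommRing R
  letI := Band.ofCommRing S
  ({ toFun := f
     map_zero' := map_zero f
     map_one' := map_one f
     map_mul' := map_mul f
     map_null := fun s (hs : s.sum = 0) => by
      change (s.map f).sum = 0
      rw [← map_multiset_sum, hs, map_zero] } : BandHom R S)

namespace KBand

/-- The bandification of a `k`-algebra. -/
def ofAlgebra (k R : Type u) [Field k] [CommRing R] [Algebra k R] : KBand k :=
  Under.mk (BandCat.ofRingHom (algebraMap k R))

/-- The monomial band model `R_ι` as a `k`-band. -/
def model {k R : Type u} [Field k] [CommRing R] [Algebra k R] (ι : AffineEmbedding k R) :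
    KBand k :=
  letI := Band.ofCommRing k
  letI := Band.ofCommRing R
  Under.mk (Y := (⟨ι.model⟩ : BandCat.{u}))
    ({ toFun := fun c => ⟨algebraMap k R c, ι.algebraMap_mem_model c⟩
       map_zero' := Subtype.ext (map_zero _)
       map_one' := Subtype.ext (map_one _)
       map_mul' := fun a b => Subtype.ext (map_mul _ a b)
       map_null := fun s (hs : s.sum = 0) => by
        change (Multiset.map Subtype.val (Multiset.map _ s)).sum = 0
        rw [Multiset.map_map]
        change (s.map (algebraMap k R)).sum = 0
        rw [← map_multiset_sum, hs, map_zero] } : BandHom k ι.model)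

/-- The inclusion `R_ι ⊆ R`. -/
def modelInclusion {k R : Type u} [Field k] [CommRing R] [Algebra k R]
    (ι : AffineEmbedding k R) : model ι ⟶ ofAlgebra k R :=
  letI := Band.ofCommRing R
  Under.homMk (SubBand.subtype ι.model) rfl

/-- The inclusion `R_j ⊆ R_ι` given by a toric morphism `φ` with `j = φ ∘ ι`. -/
def modelMap {k R : Type u} [Field k] [CommRing R] [Algebra k R]
    {ι j : AffineEmbedding k R} (φ : ι ⟶ j) : model j ⟶ model ι :=
  letI := Band.ofCommRing R
  Under.homMk (SubBand.inclusion (AffineEmbedding.model_le_of_hom φ)) rfl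

theorem specMap_id {k : Type u} [Field k] (A : KBand k) : specMap (𝟙 A) = 𝟙 A.spec :=
  Over.OverMorphism.ext (BandScheme.spec.map_id (op A.right))

theorem specMap_comp {k : Type u} [Field k] {A B C : KBand k} (f : A ⟶ B) (g : B ⟶ C) :
    specMap (f ≫ g) = specMap g ≫ specMap f :=
  Over.OverMorphism.ext (BandScheme.spec.map_comp g.right.op f.right.op)

end KBand

/-- The diagram of the band scheme models `Y_ι = Spec R_ι`, indexed by the category of closed
embeddings `ι` of `Spec R` into affine spaces and toric morphisms between them. -/
noncomputable def modelDiagram (k R : Type u) [Field k] [CommRing R] [Algebra k R] :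
    AffineEmbedding k R ⥤ KBandScheme k where
  obj ι := (KBand.model ι).spec
  map φ := KBand.specMap (KBand.modelMap φ)
  map_id ι := KBand.specMap_id (KBand.model ι)
  map_comp φ ψ := KBand.specMap_comp (KBand.modelMap ψ) (KBand.modelMap φ)

/-- The cone of the canonical morphisms `X → Y_ι` from the spectrum `X` of the bandification of `R`,
induced by the inclusions `R_ι ⊆ R`. -/
noncomputable def modelCone (k R : Type u) [Field k] [CommRing R] [Algebra k R] :
    Limits.Cone (modelDiagram k R) where
  pt := (KBand.ofAlgebra k R).spec
  π :=
    { app := fun ι => KBand.specMap (KBand.modelInclusion ι)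
      naturality := fun ι j φ => by
        change 𝟙 _ ≫ _ = KBand.specMap _ ≫ KBand.specMap _
        rw [Category.id_comp, ← KBand.specMap_comp]
        rfl }

/-! ### Limits of sets of points -/

namespace BandScheme

/-- The limit `lim F(j)(B)` of the sets of `B`-rational points of a diagram of band schemes, as a
subset of the product. -/
abbrev LimPoints {J : Type u} [Category.{u} J] (F : J ⥤ BandScheme.{u}) (B : BandCat.{u}) :
    Type u :=
  {x : ∀ j, (F.obj j).Points B // ∀ (i j : J) (φ : i ⟶ j),
    (show spec.obj (op B) ⟶ F.obj i from x i) ≫ F.map φ = x j}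

/-- The map `X(B) → lim F(j)(B)` given by a cone over the diagram with vertex `X`. -/
noncomputable def toLimPoints {J : Type u} [Category.{u} J] {F : J ⥤ BandScheme.{u}} (c : Limits.Cone F)
    (B : BandCat.{u}) (f : c.pt.Points B) : LimPoints F B :=
  ⟨fun j => (show spec.obj (op B) ⟶ c.pt from f) ≫ c.π.app j, fun i j φ => by
    change (_ ≫ _) ≫ _ = _ ≫ _
    rw [Category.assoc, c.w]⟩

end BandScheme

namespace KBandScheme

/-- The limit `lim F(j)(B)` of the sets of `B`-rational points of a diagram of `k`-band schemes, as
a subset of the product. -/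
abbrev LimPoints {k : Type u} [Field k] {J : Type u} [Category.{u} J] (F : J ⥤ KBandScheme k)
    (B : KBand k) : Type u :=
  {x : ∀ j, (F.obj j).Points B // ∀ (i j : J) (φ : i ⟶ j),
    (show B.spec ⟶ F.obj i from x i) ≫ F.map φ = x j}

/-- The map `X(B) → lim F(j)(B)` given by a cone over the diagram with vertex `X`. -/
noncomputable def toLimPoints {k : Type u} [Field k] {J : Type u} [Category.{u} J] {F : J ⥤ KBandScheme k}
    (c : Limits.Cone F) (B : KBand k) (f : c.pt.Points B) : LimPoints F B :=
  ⟨fun j => (show B.spec ⟶ c.pt from f) ≫ c.π.app j, fun i j φ => by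
    change (_ ≫ _) ≫ _ = _ ≫ _
    rw [Category.assoc, c.w]⟩

end KBandScheme

/-! The functor `spec` is adjoint to global sections: for a band scheme `Z` and a band `A`, `f ↦
globalHom f` is a bijection from the morphisms `Z ⟶ Spec A` to the band morphisms `A → 𝒪(Z)`
(`globalHom_injective`, `globalHom_surjective`). A limit of affine band schemes is thus tested on
morphisms out of their bands, and the theorem reduces to `R` being the colimit of the models `R_ι`
in the category of bands.

This holds because `R` is a directed union of the `R_ι`. Any finite set of elements lies in one
model, since elements may be added to the generators, and two embeddings are dominated by the one
that has the coordinates of both, whose projections to each are toric. A product involves two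
elements and a null sum finitely many, so compatible morphisms `R_ι → C` have a unique common
extension to `R` (`exists_hom_of_compatible`, `hom_ext_of_models`). This gives `existsUnique_lift`,
hence the limit and, for `Z = Spec B`, the bijections on points. Over `k`, compatibility with the
structure morphisms is inherited from a single `Y_ι`.

The adjunction rests on a feature of bands: primality of an m-ideal involves no addition, so the
non-units of any non-trivial band form a prime m-ideal. A morphism `B → 𝒪(V)` therefore has a center
in `Spec B`, and it extends to the stalk of `Spec B` there. If the center lies in `U`, this
evaluates sections over `U` in `𝒪(V)`; such `V` cover the preimage of `U`, and the evaluations glue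
to the pullback of sections.

For the topologies, the fine topology on `(Spec A)(B)` is pointwise convergence
(`fineTopology_spec`). As each element of `R` lies in some model, the evaluations on `R` are those
on the models, so the fine topology of `X(B)` is initial for the maps to the `Y_ι(B)`. -/

/-! ### Evaluating sections along band morphisms -/

namespace BandHom

/-- The morphism `S⁻¹B → C`, `a / t ↦ ψ a / ψ t`, for a morphism `ψ : B → C` that maps `S` to
units. -/
noncomputable def localizationLift {B C : Type u} [Band B] [Band C] (ψ : BandHom B C)
    (S : Submonoid B) (h : ∀ t : S, IsUnit (ψ t)) : BandHom (Localization S) C where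
  toFun x := (Localization.monoidOf S).lift (g := ψ.toMonoidWithZeroHom.toMonoidHom) h x
  map_zero' := by
    rw [← Localization.mk_zero 1, Localization.mk_eq_monoidOf_mk',
      Submonoid.LocalizationMap.lift_mk'_spec, mul_zero]
    exact map_zero ψ
  map_one' := map_one _
  map_mul' := map_mul _
  map_null := by
    rintro _ ⟨c, hc, t, rfl⟩
    obtain ⟨u, hu⟩ := (h t).exists_left_inv
    -- Division by `ψ t` is multiplication by its inverse `u`, and multiplication preserves null
    -- sums.
    have := Band.mul_mem_null u _ (ψ.map_mem_null hc)
    rw [Multiset.map_map] at this ⊢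
    convert! this using 1
    refine Multiset.map_congr rfl fun b _ => ?_
    rw [Function.comp_apply, Localization.mk_eq_monoidOf_mk',
      Submonoid.LocalizationMap.lift_mk'_spec]
    change ψ b = ψ t * (u * ψ b)
    rw [← mul_assoc, mul_comm (ψ t), hu, one_mul]

/-- Since `ψ t` is a unit, this equation with cleared denominator determines the value; later proofs
use only this form and cancel `ψ t`. -/
theorem mul_localizationLift_mk {B C : Type u} [Band B] [Band C] (ψ : BandHom B C)
    (S : Submonoid B) (h : ∀ t : S, IsUnit (ψ t)) (a : B) (t : S) :
    ψ t * ψ.localizationLift S h (Localization.mk a t) = ψ a := by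
  symm
  refine (Submonoid.LocalizationMap.lift_mk'_spec (f := Localization.monoidOf S)
    (g := ψ.toMonoidWithZeroHom.toMonoidHom) h a _ t).1 ?_
  rw [← Localization.mk_eq_monoidOf_mk']
  rfl

theorem nontrivial {A B : Type u} [Band A] [Band B] [Nontrivial B] (f : BandHom A B) :
    Nontrivial A := by
  refine ⟨0, 1, fun h => zero_ne_one (α := B) ?_⟩
  rw [← map_zero f, h, map_one]

end BandHom

theorem Band.mem_null_of_subsingleton {B : Type u} [Band B] [Subsingleton B] (s : Multiset B) :
    s ∈ Band.null := by
  induction s using Multiset.induction with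
  | empty => exact Band.empty_mem_null
  | cons a s ih => rwa [Subsingleton.elim a 0, Band.zero_cons_mem_null]

/-! ### Specialization of prime m-ideals, and centers of band morphisms. -/

namespace BandSpec

/-- Open subsets of the spectrum are stable under passage to smaller prime m-ideals. -/
theorem mem_of_carrier_subset {B : Type u} [Band B] {U : Set (BandSpec B)} (hU : IsOpen U)
    {p q : BandSpec B} (h : p.carrier ⊆ q.carrier) (hq : q ∈ U) : p ∈ U := by
  induction hU with
  | basic s hs =>
    obtain ⟨b, rfl⟩ := hs
    exact fun hb => hq (h hb)
  | univ => trivial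
  | inter s t _ _ hs ht => exact ⟨hs hq.1, ht hq.2⟩
  | sUnion S _ ih =>
    obtain ⟨s, hs, hqs⟩ := hq
    exact ⟨s, hs, ih s hs hqs⟩

/-- The principal open subsets form a basis. -/
theorem exists_basicOpen_subset {B : Type u} [Band B] {U : Set (BandSpec B)} (hU : IsOpen U)
    {p : BandSpec B} (hp : p ∈ U) : ∃ h : B, p ∈ basicOpen h ∧ basicOpen h ⊆ U := by
  induction hU with
  | basic s hs =>
    obtain ⟨b, rfl⟩ := hs
    exact ⟨b, hp, subset_rfl⟩
  | univ => exact ⟨1, p.one_notMem, Set.subset_univ _⟩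
  | inter s t _ _ hs ht =>
    obtain ⟨a, ha, has⟩ := hs hp.1
    obtain ⟨b, hb, hbt⟩ := ht hp.2
    refine ⟨a * b, p.compl.mul_mem ha hb, fun q hq => ⟨has fun h => hq ?_, hbt fun h => hq ?_⟩⟩
    · rw [mul_comm]
      exact q.mul_mem b a h
    · exact q.mul_mem a b h
  | sUnion S _ ih =>
    obtain ⟨s, hs, hps⟩ := hp
    obtain ⟨h, hp, hh⟩ := ih s hs hps
    exact ⟨h, hp, hh.trans (Set.subset_sUnion_of_mem hs)⟩

/-- The maximal m-ideal of a non-trivial band, which consists of its non-units. -/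
def closedPoint (C : Type u) [Band C] [Nontrivial C] : BandSpec C where
  carrier := nonunits C
  zero_mem := not_isUnit_zero
  mul_mem b a ha h := ha (isUnit_of_mul_isUnit_right h)
  one_notMem h := h isUnit_one
  mem_or_mem a b h := by
    by_contra! hab
    simp only [mem_nonunits_iff, not_not] at hab
    exact h (hab.1.mul hab.2)

/-- The preimage of the maximal m-ideal. -/
def center {B C : Type u} [Band B] [Band C] [Nontrivial C] (ψ : BandHom B C) : BandSpec B :=
  comap ψ (closedPoint C)

theorem notMem_center {B C : Type u} [Band B] [Band C] [Nontrivial C] {ψ : BandHom B C} {b : B} :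
    b ∉ (center ψ).carrier ↔ IsUnit (ψ b) :=
  not_not

/-- Units map to units, so composing further shrinks the set of elements that become non-units. By
`mem_of_carrier_subset` the center then stays in every open set that contained it. -/
theorem center_comp_subset {B C D : Type u} [Band B] [Band C] [Band D] [Nontrivial C]
    [Nontrivial D] (ρ : BandHom C D) (ψ : BandHom B C) :
    (center (ρ.comp ψ)).carrier ⊆ (center ψ).carrier := by
  intro b hb h
  exact hb (h.map ρ)

/-! ### Evaluation of sections through the stalk at the center. -/

/-- The value in `C` of sections of the structure sheaf of `Spec B`, for a morphism `ψ : B → C`. -/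
noncomputable def evalSections {B C : Type u} [Band B] [Band C] [Nontrivial C] (ψ : BandHom B C)
    (U : Set (BandSpec B)) (hU : center ψ ∈ U) : BandHom (sections U) C where
  toFun s := ψ.localizationLift (center ψ).compl (fun t => notMem_center.1 t.2) (s.1 ⟨_, hU⟩)
  map_zero' := map_zero (ψ.localizationLift _ _)
  map_one' := map_one (ψ.localizationLift _ _)
  map_mul' s t := map_mul (ψ.localizationLift _ _) (s.1 ⟨_, hU⟩) (t.1 ⟨_, hU⟩)
  map_null m hm := by
    have := (ψ.localizationLift (center ψ).compl (fun t => notMem_center.1 t.2)).map_mem_null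
      (hm ⟨_, hU⟩)
    rw [Multiset.map_map, Multiset.map_map] at this
    exact this

/-- The section `a / 1`. -/
noncomputable def ofBand {B : Type u} [Band B] (U : Set (BandSpec B)) :
    BandHom B (sections U) where
  toFun a := ⟨fun _ => Localization.mk a 1, fun p => ⟨a, 1, p.1.one_notMem, Set.univ, isOpen_univ,
    trivial, fun q _ => ⟨q.1.one_notMem, rfl⟩⟩⟩
  map_zero' := Subtype.ext (funext fun _ => Localization.mk_zero _)
  map_one' := Subtype.ext (funext fun _ => Localization.mk_one)
  map_mul' a b := Subtype.ext (funext fun p => by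
    change Localization.mk (a * b) 1 = Localization.mk a 1 * Localization.mk b 1
    rw [Localization.mk_mul, one_mul])
  map_null m hm p := by
    rw [Multiset.map_map, Multiset.map_map]
    exact ⟨m, hm, 1, rfl⟩

/-- Near the center of `ψ`, a section is a fraction `a / t` such that `ψ t` is a unit. -/
theorem exists_fraction {B C : Type u} [Band B] [Band C] [Nontrivial C] (ψ : BandHom B C)
    {U : Set (BandSpec B)} (hU : center ψ ∈ U) (s : sections U) :
    ∃ (a t : B) (W : Set (BandSpec B)), IsUnit (ψ t) ∧ IsOpen W ∧ center ψ ∈ W ∧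
      ∀ q : U, q.1 ∈ W → ∃ hq : t ∈ q.1.compl, s.1 q = Localization.mk a ⟨t, hq⟩ := by
  obtain ⟨a, t, ht, W, hW, hp, H⟩ := s.2 ⟨_, hU⟩
  exact ⟨a, t, W, notMem_center.1 ht, hW, hp, H⟩

theorem mul_evalSections {B C : Type u} [Band B] [Band C] [Nontrivial C] (ψ : BandHom B C)
    {U : Set (BandSpec B)} (hU : center ψ ∈ U) (s : sections U) {a t : B}
    (ht : t ∈ (center ψ).compl) (hs : s.1 ⟨_, hU⟩ = Localization.mk a ⟨t, ht⟩) :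
    ψ t * evalSections ψ U hU s = ψ a := by
  change _ * ψ.localizationLift _ _ _ = _
  rw [hs]
  exact ψ.mul_localizationLift_mk _ _ a ⟨t, ht⟩

theorem evalSections_ofBand {B C : Type u} [Band B] [Band C] [Nontrivial C] (ψ : BandHom B C)
    {U : Set (BandSpec B)} (hU : center ψ ∈ U) (b : B) :
    evalSections ψ U hU (ofBand U b) = ψ b := by
  have := mul_evalSections ψ hU (ofBand U b) (center ψ).one_notMem (a := b) rfl
  rwa [map_one, one_mul] at this

/-- One fraction `a / t` represents `s` on a neighbourhood of the center of `ψ`. The center of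
`ρ.comp ψ` is a smaller prime and so lies there too; both sides become `ρ (ψ a)` when multiplied by
the unit `ρ (ψ t)`. -/
theorem evalSections_comp {B C D : Type u} [Band B] [Band C] [Band D] [Nontrivial C]
    [Nontrivial D] (ρ : BandHom C D) (ψ : BandHom B C) {U : Set (BandSpec B)}
    (hU : center ψ ∈ U) (hU' : center (ρ.comp ψ) ∈ U) (s : sections U) :
    evalSections (ρ.comp ψ) U hU' s = ρ (evalSections ψ U hU s) := by
  obtain ⟨a, t, W, ht, hW, hp, H⟩ := exists_fraction ψ hU s
  obtain ⟨h1, e1⟩ := H ⟨_, hU⟩ hp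
  obtain ⟨h2, e2⟩ := H ⟨_, hU'⟩ (mem_of_carrier_subset hW (center_comp_subset ρ ψ) hp)
  have k1 := congrArg ρ (mul_evalSections ψ hU s h1 e1)
  have k2 := mul_evalSections (ρ.comp ψ) hU' s h2 e2
  rw [map_mul] at k1
  exact (ht.map ρ).mul_left_cancel (k2.trans k1.symm)

instance {B : Type u} [Band B] (p : BandSpec B) : Nontrivial p.Stalk := by
  refine ⟨0, 1, fun h => ?_⟩
  have h0 : IsUnit (Localization.mk 0 1 : p.Stalk) := by
    rw [Localization.mk_zero, h]
    exact isUnit_one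
  exact notMem_of_isUnit h0 p.zero_mem

theorem nontrivial_sections {B : Type u} [Band B] {U : Set (BandSpec B)} {p : BandSpec B}
    (hp : p ∈ U) : Nontrivial (sections U) :=
  ⟨0, 1, fun h => zero_ne_one (α := p.Stalk) (congrFun (congrArg Subtype.val h) ⟨p, hp⟩)⟩

/-- A section whose value at a point is a unit is invertible near that point. -/
theorem exists_isOpen_isUnit {B : Type u} [Band B] {U : Set (BandSpec B)} (hU : IsOpen U)
    (s : sections U) (p : U) (h : IsUnit (s.1 p)) :
    ∃ (W : Set (BandSpec B)) (i : W ⊆ U), IsOpen W ∧ p.1 ∈ W ∧ IsUnit (restrict i s) := by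
  obtain ⟨a, g, hg, W, hW, hpW, H⟩ := s.2 p
  have ha : a ∉ p.1.carrier := by
    obtain ⟨_, e⟩ := H _ hpW
    rw [e] at h
    exact notMem_of_isUnit h
  refine ⟨U ∩ (W ∩ basicOpen a), Set.inter_subset_left,
    hU.inter (hW.inter (isOpen_basicOpen a)), ⟨p.2, hpW, ha⟩, isUnit_of_forall _ fun q => ?_⟩
  obtain ⟨h2, e2⟩ := H ⟨q.1, q.2.1⟩ q.2.2.1
  exact IsUnit.of_mul_eq_one _
    ((congrArg (· * _) e2).trans (isUnit_mk (p := q.1) q.2.2.2 h2))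

end BandSpec

/-! ### Sheaves of bands -/

namespace BandSpace

/-- The sections of a sheaf of bands over an open set. -/
abbrev Sec (Z : BandSpace.{u}) (V : Opens Z) : BandCat.{u} := Z.presheaf.obj (op V)

/-- Restriction of sections of a sheaf of bands. -/
def res (Z : BandSpace.{u}) {V W : Opens Z} (i : V ≤ W) : BandHom (Z.Sec W) (Z.Sec V) :=
  Z.presheaf.map (homOfLE i).op

theorem res_comp_res (Z : BandSpace.{u}) {U V W : Opens Z} (i : U ≤ V) (j : V ≤ W) :
    (Z.res i).comp (Z.res j) = Z.res (i.trans j) :=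
  (Z.presheaf.map_comp (homOfLE j).op (homOfLE i).op).symm

theorem res_res (Z : BandSpace.{u}) {U V W : Opens Z} (i : U ≤ V) (j : V ≤ W) (s : Z.Sec W) :
    Z.res i (Z.res j s) = Z.res (i.trans j) s :=
  DFunLike.congr_fun (Z.res_comp_res i j) s

/-- The sheaf of sets of morphisms from a band into a sheaf of bands. -/
def homSheaf (Z : BandSpace.{u}) (E : BandCat.{u}) : TopCat.Sheaf (Type u) Z :=
  ⟨Z.presheaf ⋙ coyoneda.obj (op E), (isSheaf_iff_isSheaf_of_type _ _).2 (Z.IsSheaf E)⟩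

/-- Morphisms into a sheaf of bands are determined locally. -/
theorem hom_ext_of_cover (Z : BandSpace.{u}) {E : BandCat.{u}} {W : Opens Z} {I : Type u}
    (V : I → Opens Z) (i : ∀ j, V j ≤ W) (hV : W ≤ iSup V) (f g : BandHom E (Z.Sec W))
    (h : ∀ j, (Z.res (i j)).comp f = (Z.res (i j)).comp g) : f = g :=
  (Z.homSheaf E).eq_of_locally_eq' V W (fun j => homOfLE (i j)) hV f g h

/-- Morphisms into a sheaf of bands can be glued. -/
theorem exists_hom_of_cover (Z : BandSpace.{u}) {E : BandCat.{u}} {W : Opens Z} {I : Type u}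
    (V : I → Opens Z) (i : ∀ j, V j ≤ W) (hV : W ≤ iSup V) (f : ∀ j, BandHom E (Z.Sec (V j)))
    (h : ∀ j k, (Z.res (inf_le_left : V j ⊓ V k ≤ V j)).comp (f j) =
      (Z.res (inf_le_right : V j ⊓ V k ≤ V k)).comp (f k)) :
    ∃ g : BandHom E (Z.Sec W), ∀ j, (Z.res (i j)).comp g = f j := by
  let f' : ∀ j, ToType ((Z.homSheaf E).1.obj (op (V j))) := f
  have h' : TopCat.Presheaf.IsCompatible (Z.homSheaf E).1 V f' := h
  exact ((Z.homSheaf E).existsUnique_gluing' V W (fun j => homOfLE (i j)) hV f' h').exists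

/-- All stalks are non-trivial. -/
def HasNontrivialStalks (Z : BandSpace.{u}) : Prop :=
  ∀ (V : Opens Z), ∀ z ∈ V, Nontrivial (Z.Sec V)

theorem isUnitAt_iff (Z : BandSpace.{u}) {U : Opens Z} (s : Z.Sec U) (z : Z) :
    IsUnitAt Z s z ↔ ∃ (V : Opens Z) (i : V ≤ U), z ∈ V ∧ IsUnit (Z.res i s) :=
  Iff.rfl

theorem IsUnitAt.mul {Z : BandSpace.{u}} {U : Opens Z} {s t : Z.Sec U} {z : Z}
    (hs : IsUnitAt Z s z) (ht : IsUnitAt Z t z) : IsUnitAt Z (s * t) z := by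
  rw [isUnitAt_iff] at *
  obtain ⟨V, i, hV, h⟩ := hs
  obtain ⟨W, j, hW, h'⟩ := ht
  refine ⟨V ⊓ W, inf_le_left.trans i, ⟨hV, hW⟩, ?_⟩
  rw [map_mul]
  refine IsUnit.mul ?_ ?_
  · rw [← Z.res_res inf_le_left i]
    exact h.map (Z.res _)
  · rw [← Z.res_res inf_le_right j]
    exact h'.map (Z.res _)

/-! ### The continuous map to `Spec B` given by a morphism into global sections. -/

/-- The prime m-ideal of functions in `B` that are not invertible at `z`. -/
def basePoint {Z : BandSpace.{u}} (hZ : Z.HasNontrivialStalks) {B : BandCat.{u}}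
    (φ : BandHom B (Z.Sec ⊤)) (z : Z) : BandSpec B where
  carrier := {b | ¬ IsUnitAt Z (φ b) z}
  zero_mem := by
    rintro ⟨V, i, hV, h⟩
    have := hZ V z hV
    change IsUnit (Z.res i (φ 0)) at h
    rw [map_zero, map_zero] at h
    exact not_isUnit_zero h
  mul_mem := by
    rintro b a ha ⟨V, i, hV, h⟩
    refine ha ⟨V, i, hV, ?_⟩
    change IsUnit (Z.res i (φ (b * a))) at h
    rw [map_mul, map_mul] at h
    exact isUnit_of_mul_isUnit_right h
  one_notMem := by
    refine not_not.2 ⟨⊤, le_rfl, trivial, ?_⟩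
    change IsUnit (Z.res _ (φ 1))
    rw [map_one, map_one]
    exact isUnit_one
  mem_or_mem := by
    intro a b h
    by_contra! hab
    simp only [Set.mem_ofPred_eq, not_not] at hab h
    refine h ?_
    rw [map_mul]
    exact hab.1.mul hab.2

theorem notMem_basePoint {Z : BandSpace.{u}} {hZ : Z.HasNontrivialStalks} {B : BandCat.{u}}
    {φ : BandHom B (Z.Sec ⊤)} {z : Z} {b : B} :
    b ∉ (basePoint hZ φ z).carrier ↔
      ∃ V : Opens Z, z ∈ V ∧ IsUnit (Z.res (le_top : V ≤ ⊤) (φ b)) := by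
  refine not_not.trans ⟨?_, ?_⟩
  · rintro ⟨V, i, hV, h⟩
    exact ⟨V, hV, h⟩
  · rintro ⟨V, hV, h⟩
    exact ⟨V, le_top, hV, h⟩

theorem continuous_basePoint {Z : BandSpace.{u}} (hZ : Z.HasNontrivialStalks) {B : BandCat.{u}}
    (φ : BandHom B (Z.Sec ⊤)) : Continuous (basePoint hZ φ) := by
  refine continuous_generateFrom_iff.2 ?_
  rintro _ ⟨b, rfl⟩
  rw [isOpen_iff_forall_mem_open]
  intro z hz
  obtain ⟨V, hzV, h⟩ := notMem_basePoint.1 hz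
  exact ⟨V, fun y hy => notMem_basePoint.2 ⟨V, hy, h⟩, V.2, hzV⟩

/-- The morphism `B → 𝒪(V)` given by a morphism `B → 𝒪(Z)`. -/
def toSec {Z : BandSpace.{u}} {B : BandCat.{u}} (φ : BandHom B (Z.Sec ⊤)) (V : Opens Z) :
    BandHom B (Z.Sec V) :=
  (Z.res (le_top : V ≤ ⊤)).comp φ

theorem res_comp_toSec {Z : BandSpace.{u}} {B : BandCat.{u}} (φ : BandHom B (Z.Sec ⊤))
    {V W : Opens Z} (i : V ≤ W) : (Z.res i).comp (toSec φ W) = toSec φ V :=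
  congrArg (fun ψ => BandHom.comp ψ φ) (Z.res_comp_res i le_top)

/-- What is invertible on all of `V` is invertible at each point of `V`. -/
theorem basePoint_subset_center {Z : BandSpace.{u}} (hZ : Z.HasNontrivialStalks) {B : BandCat.{u}}
    (φ : BandHom B (Z.Sec ⊤)) {V : Opens Z} [Nontrivial (Z.Sec V)] {z : Z} (hz : z ∈ V) :
    (basePoint hZ φ z).carrier ⊆ (BandSpec.center (toSec φ V)).carrier := by
  intro b hb
  by_contra h
  exact notMem_basePoint.2 ⟨V, hz, BandSpec.notMem_center.1 h⟩ hb

/-- The center of `B → 𝒪(V)` lies in a given neighbourhood of the image of `z` if `V` is a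
small enough neighbourhood of `z`. -/
theorem exists_center_mem {Z : BandSpace.{u}} (hZ : Z.HasNontrivialStalks) {B : BandCat.{u}}
    (φ : BandHom B (Z.Sec ⊤)) {U : Set (BandSpec B)} (hU : IsOpen U) {z : Z}
    (hz : basePoint hZ φ z ∈ U) :
    ∃ V : Opens Z, z ∈ V ∧ ∃ _ : Nontrivial (Z.Sec V), BandSpec.center (toSec φ V) ∈ U := by
  -- For a principal open `U_h`, the center condition is invertibility of `h` on `V`, which holds on
  -- some neighbourhood of `z`.
  obtain ⟨h, hzh, hhU⟩ := BandSpec.exists_basicOpen_subset hU hz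
  obtain ⟨V, hzV, hV⟩ := notMem_basePoint.1 hzh
  have hV' := hZ V z hzV
  exact ⟨V, hzV, hV', hhU (BandSpec.notMem_center.2 hV)⟩

theorem center_mem_of_le {Z : BandSpace.{u}} {B : BandCat.{u}} (φ : BandHom B (Z.Sec ⊤))
    {U : Set (BandSpec B)} (hU : IsOpen U) {V W : Opens Z} [Nontrivial (Z.Sec V)]
    [Nontrivial (Z.Sec W)] (i : V ≤ W) (hW : BandSpec.center (toSec φ W) ∈ U) :
    BandSpec.center (toSec φ V) ∈ U := by
  refine BandSpec.mem_of_carrier_subset hU ?_ hW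
  rw [← res_comp_toSec φ i]
  exact BandSpec.center_comp_subset _ _

/-! ### Gluing the pullback of sections from small open sets. -/

/-- The open subsets `V` of `Z` such that the center of `B → 𝒪(V)` lies in `U`. -/
structure SmallOpen {Z : BandSpace.{u}} {B : BandCat.{u}} (φ : BandHom B (Z.Sec ⊤))
    (U : Set (BandSpec B)) : Type u where
  V : Opens Z
  [nontrivial : Nontrivial (Z.Sec V)]
  center_mem : BandSpec.center (toSec φ V) ∈ U

namespace SmallOpen

attribute [instance] SmallOpen.nontrivial

theorem basePoint_mem {Z : BandSpace.{u}} (hZ : Z.HasNontrivialStalks) {B : BandCat.{u}}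
    {φ : BandHom B (Z.Sec ⊤)} {U : Set (BandSpec B)} (hU : IsOpen U) (j : SmallOpen φ U)
    {z : Z} (hz : z ∈ j.V) : basePoint hZ φ z ∈ U :=
  BandSpec.mem_of_carrier_subset hU (basePoint_subset_center hZ φ hz) j.center_mem

/-- Evaluation of sections over `U` in `𝒪(V)`. -/
noncomputable def eval {Z : BandSpace.{u}} {B : BandCat.{u}} {φ : BandHom B (Z.Sec ⊤)}
    {U : Set (BandSpec B)} (j : SmallOpen φ U) : BandHom (BandSpec.sections U) (Z.Sec j.V) :=
  BandSpec.evalSections (toSec φ j.V) U j.center_mem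

theorem res_eval {Z : BandSpace.{u}} {B : BandCat.{u}} {φ : BandHom B (Z.Sec ⊤)}
    {U : Set (BandSpec B)} {j k : SmallOpen φ U} (i : j.V ≤ k.V) (s : BandSpec.sections U) :
    Z.res i (k.eval s) = j.eval s := by
  -- The membership of the center in `U` depends on the morphism, so the equation `res_comp_toSec`
  -- cannot simply be rewritten; with a variable `ψ` it can be substituted.
  have key : ∀ (ψ : BandHom B (Z.Sec j.V)), (Z.res i).comp (toSec φ k.V) = ψ →
      ∀ hψ : BandSpec.center ψ ∈ U,
      Z.res i (k.eval s) = BandSpec.evalSections ψ U hψ s := by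
    rintro _ rfl hψ
    exact (BandSpec.evalSections_comp _ _ k.center_mem hψ s).symm
  exact key _ (res_comp_toSec φ i) j.center_mem

end SmallOpen

/-- The preimage of an open subset of `Spec B`. -/
def preimage {Z : BandSpace.{u}} (hZ : Z.HasNontrivialStalks) {B : BandCat.{u}}
    (φ : BandHom B (Z.Sec ⊤)) (U : Opens (TopCat.of (BandSpec B))) : Opens Z :=
  (Opens.map (TopCat.ofHom ⟨basePoint hZ φ, continuous_basePoint hZ φ⟩)).obj U

theorem SmallOpen.le_preimage {Z : BandSpace.{u}} (hZ : Z.HasNontrivialStalks) {B : BandCat.{u}}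
    {φ : BandHom B (Z.Sec ⊤)} {U : Opens (TopCat.of (BandSpec B))}
    (j : SmallOpen φ (SetLike.coe U)) : j.V ≤ preimage hZ φ U :=
  fun _ hz => j.basePoint_mem hZ U.2 hz

theorem preimage_le_iSup {Z : BandSpace.{u}} (hZ : Z.HasNontrivialStalks) {B : BandCat.{u}}
    (φ : BandHom B (Z.Sec ⊤)) (U : Opens (TopCat.of (BandSpec B))) :
    preimage hZ φ U ≤ ⨆ j : SmallOpen φ (SetLike.coe U), j.V := by
  intro z hz
  obtain ⟨V, hzV, hV, hc⟩ := exists_center_mem hZ φ U.2 hz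
  exact Opens.mem_iSup.2 ⟨⟨V, hc⟩, hzV⟩

/-- The small open sets cover the preimage of `U`, and by `SmallOpen.res_eval` the evaluations on
two of them agree on the overlap. -/
theorem exists_pullback {Z : BandSpace.{u}} (hZ : Z.HasNontrivialStalks) {B : BandCat.{u}}
    (φ : BandHom B (Z.Sec ⊤)) (U : Opens (TopCat.of (BandSpec B))) :
    ∃ g : BandHom (BandSpec.sections (SetLike.coe U)) (Z.Sec (preimage hZ φ U)),
      ∀ j : SmallOpen φ (SetLike.coe U), (Z.res (j.le_preimage hZ)).comp g = j.eval := by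
  refine Z.exists_hom_of_cover (E := ⟨BandSpec.sections (SetLike.coe U)⟩) _ _
    (preimage_le_iSup hZ φ U) _ fun j k => BandHom.ext fun s => ?_
  by_cases h : Nontrivial (Z.Sec (j.V ⊓ k.V))
  · let l : SmallOpen φ (SetLike.coe U) :=
      ⟨j.V ⊓ k.V, center_mem_of_le φ U.2 inf_le_left j.center_mem⟩
    exact (SmallOpen.res_eval (j := l) inf_le_left s).trans
      (SmallOpen.res_eval (j := l) inf_le_right s).symm
  -- An overlap with a trivial band of sections is no `SmallOpen`, but equality there is automatic.
  · have := not_nontrivial_iff_subsingleton.1 h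
    exact Subsingleton.elim _ _

/-- The pullback of sections along the morphism `Z → Spec B` given by `B → 𝒪(Z)`. -/
noncomputable def pullback {Z : BandSpace.{u}} (hZ : Z.HasNontrivialStalks) {B : BandCat.{u}}
    (φ : BandHom B (Z.Sec ⊤)) (U : Opens (TopCat.of (BandSpec B))) :
    BandHom (BandSpec.sections (SetLike.coe U)) (Z.Sec (preimage hZ φ U)) :=
  (exists_pullback hZ φ U).choose

theorem res_pullback {Z : BandSpace.{u}} (hZ : Z.HasNontrivialStalks) {B : BandCat.{u}}
    (φ : BandHom B (Z.Sec ⊤)) (U : Opens (TopCat.of (BandSpec B)))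
    (j : SmallOpen φ (SetLike.coe U)) (s : BandSpec.sections (SetLike.coe U)) :
    Z.res (j.le_preimage hZ) (pullback hZ φ U s) = j.eval s :=
  DFunLike.congr_fun ((exists_pullback hZ φ U).choose_spec j) s

/-- The morphism of sheafed spaces `Z → Spec B` given by a morphism `B → 𝒪(Z)`. -/
noncomputable def toSpec {Z : BandSpace.{u}} (hZ : Z.HasNontrivialStalks) {B : BandCat.{u}}
    (φ : BandHom B (Z.Sec ⊤)) : Z ⟶ B.specSpace where
  hom :=
    { base := TopCat.ofHom ⟨basePoint hZ φ, continuous_basePoint hZ φ⟩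
      c :=
      { app := fun U => pullback hZ φ U.unop
        naturality := fun U U' i => by
          refine Z.hom_ext_of_cover (E := ⟨BandSpec.sections (SetLike.coe U.unop)⟩)
            (fun j : SmallOpen φ (SetLike.coe U'.unop) => j.V) (fun j => j.le_preimage hZ)
            (preimage_le_iSup hZ φ U'.unop) _ _ fun j => BandHom.ext fun s => ?_
          have hi : U'.unop ≤ U.unop := leOfHom i.unop
          -- The same `V` is small for the larger `U`, and evaluating a restricted section there is
          -- evaluating the section itself.
          let k : SmallOpen φ (SetLike.coe U.unop) := ⟨j.V, hi j.center_mem⟩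
          refine (res_pullback hZ φ U'.unop j (BandSpec.restrict hi s)).trans ?_
          refine (res_pullback hZ φ U.unop k s).symm.trans ?_
          exact (Z.res_res (j.le_preimage hZ) (fun z hz => hi hz) (pullback hZ φ U.unop s)).symm } }

/-- On a small neighbourhood of `z`, write `s = a / t` near the center. If the pullback of `s` is a
unit there, so is the image of `a`, hence `a` is outside the prime of `z`. The same fraction
represents `s` at that prime, so `s` is a unit in its stalk. -/
theorem isLocal_toSpec {Z : BandSpace.{u}} (hZ : Z.HasNontrivialStalks) {B : BandCat.{u}}
    (φ : BandHom B (Z.Sec ⊤)) : IsLocal (toSpec hZ φ) := by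
  intro U s z hz ⟨V, i, hzV, hV⟩
  obtain ⟨W, hzW, hW, hc⟩ := exists_center_mem hZ φ U.2 hz
  have hzVW : z ∈ V ⊓ W := ⟨hzV, hzW⟩
  have hVW := hZ _ z hzVW
  let j : SmallOpen φ (SetLike.coe U) := ⟨V ⊓ W, center_mem_of_le φ U.2 inf_le_right hc⟩
  have hu : IsUnit (j.eval s) := by
    refine res_pullback hZ φ U j s ▸ ?_
    refine Z.res_res inf_le_left i (pullback hZ φ U s) ▸ ?_
    exact hV.map (Z.res inf_le_left)
  obtain ⟨a, t, O, ht, hO, hcO, H⟩ := BandSpec.exists_fraction (toSec φ j.V) j.center_mem s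
  obtain ⟨h1, e1⟩ := H ⟨_, j.center_mem⟩ hcO
  have ha : IsUnit (toSec φ j.V a) := by
    rw [← BandSpec.mul_evalSections _ j.center_mem s h1 e1]
    exact ht.mul hu
  have hz' := basePoint_subset_center hZ φ hzVW
  obtain ⟨h2, e2⟩ := H ⟨basePoint hZ φ z, hz⟩ (BandSpec.mem_of_carrier_subset hO hz' hcO)
  have ha' : a ∉ (basePoint hZ φ z).carrier := fun h => hz' h ha
  have hs : IsUnit (s.1 ⟨basePoint hZ φ z, hz⟩) :=
    IsUnit.of_mul_eq_one _ ((congrArg (· * _) e2).trans (BandSpec.isUnit_mk ha' h2))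
  obtain ⟨W', i', hW', hzW', h'⟩ := BandSpec.exists_isOpen_isUnit U.2 s _ hs
  exact ⟨⟨W', hW'⟩, i', hzW', h'⟩

/-! ### Recovering a local morphism from its effect on global sections. -/

/-- The pullback of sections along a morphism of sheafed spaces `Z → Spec B`. -/
def appHom {Z : BandSpace.{u}} {B : BandCat.{u}} (f : Z ⟶ B.specSpace)
    (U : Opens (TopCat.of (BandSpec B))) :
    BandHom (BandSpec.sections (SetLike.coe U)) (Z.Sec ((Opens.map f.hom.base).obj U)) :=
  f.hom.c.app (op U)

theorem appHom_restrict {Z : BandSpace.{u}} {B : BandCat.{u}} (f : Z ⟶ B.specSpace)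
    {U W : Opens (TopCat.of (BandSpec B))} (i : W ≤ U) (s : BandSpec.sections (SetLike.coe U)) :
    appHom f W (BandSpec.restrict i s) = Z.res (fun _ hz => i hz) (appHom f U s) :=
  DFunLike.congr_fun (F := BandHom _ _) (f.hom.c.naturality (homOfLE i).op) s

/-- The morphism `B → 𝒪(Z)` given by a morphism of sheafed spaces `Z → Spec B`. -/
noncomputable def globalHom {Z : BandSpace.{u}} {B : BandCat.{u}} (f : Z ⟶ B.specSpace) :
    BandHom B (Z.Sec ⊤) :=
  BandHom.comp (appHom f ⊤)
    (BandSpec.ofBand (SetLike.coe (⊤ : Opens (TopCat.of (BandSpec B)))))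

theorem globalHom_toSpec {Z : BandSpace.{u}} (hZ : Z.HasNontrivialStalks) {B : BandCat.{u}}
    (φ : BandHom B (Z.Sec ⊤)) : globalHom (toSpec hZ φ) = φ := by
  refine Z.hom_ext_of_cover (fun j : SmallOpen φ (SetLike.coe ⊤) => j.V)
    (fun j => j.le_preimage hZ) (preimage_le_iSup hZ φ ⊤) _ _ fun j => BandHom.ext fun b => ?_
  refine (res_pullback hZ φ ⊤ j _).trans ?_
  exact BandSpec.evalSections_ofBand _ j.center_mem b

/-- If `b` is outside the prime `f(z)`, then `b / 1` is invertible near `f(z)` and its pullback near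
`z`. The converse is locality of `f`. -/
theorem base_eq_basePoint {Z : BandSpace.{u}} (hZ : Z.HasNontrivialStalks) {B : BandCat.{u}}
    {f : Z ⟶ B.specSpace} (hf : IsLocal f) (z : Z) :
    f.hom.base z = basePoint hZ (globalHom f) z := by
  refine BandSpec.ext (Set.ext fun b => not_iff_not.1 ⟨fun h => ?_, fun h => ?_⟩)
  · have hu : IsUnit ((BandSpec.ofBand (Set.univ : Set (BandSpec B)) b).1
        ⟨f.hom.base z, trivial⟩) :=
      IsUnit.of_mul_eq_one _ (BandSpec.isUnit_mk h (BandSpec.one_notMem _))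
    obtain ⟨W, i, hW, hzW, h'⟩ := BandSpec.exists_isOpen_isUnit isOpen_univ _ _ hu
    let W' : Opens (TopCat.of (BandSpec B)) := ⟨W, hW⟩
    refine notMem_basePoint.2 ⟨(Opens.map f.hom.base).obj W', hzW, ?_⟩
    have := h'.map (appHom f W')
    exact appHom_restrict f (le_top : W' ≤ ⊤) (BandSpec.ofBand Set.univ b) ▸ this
  · obtain ⟨V, hzV, hV⟩ := notMem_basePoint.1 h
    obtain ⟨W, i, hzW, hW⟩ := hf ⊤ (BandSpec.ofBand Set.univ b) z trivial ⟨V, le_top, hzV, hV⟩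
    obtain ⟨t, ht⟩ := hW.exists_right_inv
    exact BandSpec.notMem_of_isUnit (t := 1)
      (IsUnit.of_mul_eq_one _ (congrFun (congrArg Subtype.val ht) ⟨f.hom.base z, hzW⟩))

/-- The pullback of sections along `Z → Spec B` is locally evaluation along `B → 𝒪(V)`. -/
theorem res_app {Z : BandSpace.{u}} (hZ : Z.HasNontrivialStalks) {B : BandCat.{u}}
    {f : Z ⟶ B.specSpace} (hf : IsLocal f) (U : Opens (TopCat.of (BandSpec B)))
    (j : SmallOpen (globalHom f) (SetLike.coe U))
    (hj : j.V ≤ (Opens.map f.hom.base).obj U)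
    (s : BandSpec.sections (SetLike.coe U)) :
    Z.res hj (appHom f U s) = j.eval s := by
  obtain ⟨a, t, O, ht, hO, hcO, H⟩ :=
    BandSpec.exists_fraction (toSec (globalHom f) j.V) j.center_mem s
  obtain ⟨h1, e1⟩ := H ⟨_, j.center_mem⟩ hcO
  refine ht.mul_left_cancel (Eq.trans ?_ (BandSpec.mul_evalSections _ j.center_mem s h1 e1).symm)
  -- Over `W` the relation `t * s = a` holds between `s` and restrictions of global sections, whose
  -- pullbacks are given by `globalHom f`. Cancelling the unit `t` then determines the pullback of
  -- `s`.
  let W : Opens (TopCat.of (BandSpec B)) := U ⊓ ⟨O, hO⟩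
  have hs : BandSpec.ofBand (SetLike.coe W) t * BandSpec.restrict inf_le_left s =
      BandSpec.ofBand (SetLike.coe W) a := by
    refine Subtype.ext (funext fun q => ?_)
    obtain ⟨h2, e2⟩ := H ⟨q.1, q.2.1⟩ q.2.2
    change Localization.mk t 1 * s.1 ⟨q.1, q.2.1⟩ = Localization.mk a 1
    rw [e2, Localization.mk_mul, Localization.mk_eq_mk_iff, Localization.r_iff_exists]
    exact ⟨1, by simp⟩
  have hjW : j.V ≤ (Opens.map f.hom.base).obj W := by
    intro z hz
    refine ⟨hj hz, ?_⟩
    change f.hom.base z ∈ O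
    rw [base_eq_basePoint hZ hf]
    exact BandSpec.mem_of_carrier_subset hO (basePoint_subset_center hZ _ hz) hcO
  have key : ∀ b : B, Z.res hjW (appHom f W (BandSpec.ofBand (SetLike.coe W) b)) =
      toSec (globalHom f) j.V b := by
    intro b
    exact (congrArg (Z.res hjW)
      (appHom_restrict f (le_top : W ≤ ⊤) (BandSpec.ofBand Set.univ b))).trans
      (Z.res_res hjW (fun _ _ => Set.mem_univ _) (globalHom f b))
  have nat : Z.res hjW (appHom f W (BandSpec.restrict inf_le_left s)) =
      Z.res hj (appHom f U s) :=
    (congrArg (Z.res hjW) (appHom_restrict f (inf_le_left : W ≤ U) s)).trans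
      (Z.res_res hjW (fun _ hz => hz.1) _)
  have := congrArg (fun x => Z.res hjW (appHom f W x)) hs
  dsimp only at this
  rwa [map_mul, map_mul, key, key, nat] at this

/-- The base map is fixed by `base_eq_basePoint`, and by `res_app` the pullbacks agree on a cover by
small open sets. -/
theorem globalHom_injective {Z : BandSpace.{u}} (hZ : Z.HasNontrivialStalks) {B : BandCat.{u}}
    {f g : Z ⟶ B.specSpace} (hf : IsLocal f) (hg : IsLocal g) (h : globalHom f = globalHom g) :
    f = g := by
  have hbase : f.hom.base = g.hom.base := by
    ext z
    rw [base_eq_basePoint hZ hf, base_eq_basePoint hZ hg, h]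
  -- The consequences of locality are recorded in terms of one global morphism before `f` and `g`
  -- are destructured, so that the two base maps can be identified by substitution.
  have hfb : ∀ z, f.hom.base z = basePoint hZ (globalHom f) z := base_eq_basePoint hZ hf
  have hfr := res_app hZ hf
  have hgr := res_app hZ hg
  rw [← h] at hgr
  clear hf hg h
  generalize globalHom f = φ at *
  obtain ⟨⟨b, c⟩⟩ := f
  obtain ⟨⟨b', c'⟩⟩ := g
  dsimp only at hbase
  subst hbase
  apply InducedCategory.hom_ext
  refine congrArg (PresheafedSpace.Hom.mk b) (NatTrans.ext (funext fun U => ?_))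
  have hle : ∀ j : SmallOpen φ (SetLike.coe U.unop), j.V ≤ (Opens.map b).obj U.unop := by
    intro j z hz
    change b z ∈ U.unop
    rw [hfb z]
    exact j.basePoint_mem hZ U.unop.2 hz
  refine Z.hom_ext_of_cover (E := ⟨BandSpec.sections (SetLike.coe U.unop)⟩)
    (fun j : SmallOpen φ (SetLike.coe U.unop) => j.V) hle ?_ _ _ fun j => BandHom.ext fun s => ?_
  · intro z hz
    refine preimage_le_iSup hZ φ U.unop ?_
    change basePoint hZ φ z ∈ U.unop
    rw [← hfb z]
    exact hz
  · exact (hfr U.unop j (hle j) s).trans (hgr U.unop j (hle j) s).symm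

end BandSpace

/-! ### Morphisms from band schemes to affine band schemes -/

namespace BandScheme

/-- Sections over `V` map to sections over a set of primes in an affine chart at `z`. That set
contains the point of `z`, whose stalk is non-trivial, and a band mapping to a non-trivial one is
non-trivial. -/
theorem hasNontrivialStalks (Z : BandScheme.{u}) : Z.toBandSpace.HasNontrivialStalks := by
  intro V z hz
  obtain ⟨U, B, ⟨e⟩⟩ := Z.local_affine z
  let j : B.specSpace.toPresheafedSpace ⟶ Z.toBandSpace.toPresheafedSpace :=
    e.inv.hom ≫ Z.toBandSpace.toPresheafedSpace.ofRestrict U.isOpenEmbedding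
  have hj : j.base (e.hom.hom.base ⟨z, U.2⟩) = z := by
    have h : (e.hom ≫ e.inv).hom.base ⟨z, U.2⟩ = ⟨z, U.2⟩ := by
      rw [e.hom_inv_id]
      rfl
    exact congrArg Subtype.val h
  have : Nontrivial (BandSpec.sections (SetLike.coe ((Opens.map j.base).obj V))) :=
    BandSpec.nontrivial_sections (p := e.hom.hom.base ⟨z, U.2⟩) (by
      change j.base _ ∈ V
      rwa [hj])
  let g : BandHom (Z.toBandSpace.Sec V)
    (BandSpec.sections (SetLike.coe ((Opens.map j.base).obj V))) := j.c.app (op V)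
  exact g.nontrivial

/-- The morphism `A → 𝒪(Z)` given by a morphism `Z → Spec A`. -/
noncomputable def globalHom {Z : BandScheme.{u}} {A : BandCat.{u}} (f : Z ⟶ spec.obj (op A)) :
    BandHom A (Z.toBandSpace.Sec ⊤) :=
  BandSpace.globalHom (B := A) f.hom

theorem globalHom_injective {Z : BandScheme.{u}} {A : BandCat.{u}} {f g : Z ⟶ spec.obj (op A)}
    (h : globalHom f = globalHom g) : f = g :=
  Hom.ext (BandSpace.globalHom_injective Z.hasNontrivialStalks f.isLocal g.isLocal h)

theorem globalHom_surjective {Z : BandScheme.{u}} {A : BandCat.{u}}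
    (φ : BandHom A (Z.toBandSpace.Sec ⊤)) : ∃ f : Z ⟶ spec.obj (op A), globalHom f = φ :=
  ⟨⟨BandSpace.toSpec Z.hasNontrivialStalks φ, BandSpace.isLocal_toSpec _ φ⟩,
    BandSpace.globalHom_toSpec _ φ⟩

theorem pullback_ofBand {A B : Type u} [Band A] [Band B] (g : BandHom A B) (a : A) :
    BandSpec.pullback g Set.univ (BandSpec.ofBand Set.univ a) =
      BandSpec.ofBand Set.univ (g a) := by
  refine Subtype.ext (funext fun q => ?_)
  change Localization.mk (g a) _ = Localization.mk _ _
  congr 1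
  exact Subtype.ext (map_one g)

/-- Naturality of the adjunction in the band: it turns compatibility of morphisms to the `Y_ι` into
compatibility of morphisms out of the `R_ι`. -/
theorem globalHom_comp_specMap {Z : BandScheme.{u}} {A B : BandCat.{u}} (g : BandHom A B)
    (f : Z ⟶ spec.obj (op B)) :
    globalHom (f ≫ spec.map (show A ⟶ B from g).op) = (globalHom f).comp g :=
  BandHom.ext fun a => congrArg (BandSpace.appHom (B := B) f.hom ⊤) (pullback_ofBand g a)

theorem globalHom_specMap {A B : BandCat.{u}} (g : BandHom A B) (a : A) :
    globalHom (spec.map (show A ⟶ B from g).op) a = BandSpec.ofBand Set.univ (g a) :=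
  pullback_ofBand g a

end BandScheme

/-! ### Global sections of an affine band scheme. -/

namespace BandSpec

/-- Every section over the spectrum is given by an element of the band. -/
theorem exists_globalSections (B : Type u) [Band B] :
    ∃ ρ : BandHom (sections (Set.univ : Set (BandSpec B))) B,
      (∀ b, ρ (ofBand Set.univ b) = b) ∧ ∀ s, ofBand Set.univ (ρ s) = s := by
  by_cases hB : Nontrivial B
  · have hU : center (BandHom.id B) ∈ (Set.univ : Set (BandSpec B)) := Set.mem_univ _
    refine ⟨evalSections (BandHom.id B) Set.univ hU, evalSections_ofBand _ hU,
      fun s => Subtype.ext (funext fun q => ?_)⟩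
    obtain ⟨a, t, W, ht, hW, hc, H⟩ := exists_fraction (BandHom.id B) hU s
    obtain ⟨h1, e1⟩ := H ⟨_, hU⟩ hc
    -- A prime m-ideal contains no unit, so it lies in the closed point; a neighbourhood of the
    -- closed point is therefore the whole spectrum, and `a / t` represents `s` everywhere.
    have hq : q.1.carrier ⊆ (center (BandHom.id B)).carrier := by
      intro b hb
      by_contra h
      obtain ⟨c, hc⟩ := (notMem_center.1 h).exists_left_inv
      exact q.1.one_notMem (hc ▸ q.1.mul_mem c b hb)
    obtain ⟨h2, e2⟩ := H q (mem_of_carrier_subset hW hq hc)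
    rw [e2]
    change Localization.mk _ _ = _
    rw [Localization.mk_eq_mk_iff, Localization.r_iff_exists]
    refine ⟨1, ?_⟩
    have := mul_evalSections (BandHom.id B) hU s h1 e1
    simpa using this
  -- For the trivial band both sides are trivial, since `ofBand` would carry non-triviality back to
  -- `B`.
  · have := not_nontrivial_iff_subsingleton.1 hB
    have h : Subsingleton (sections (Set.univ : Set (BandSpec B))) :=
      not_nontrivial_iff_subsingleton.1 fun _ => hB (ofBand Set.univ).nontrivial
    exact ⟨⟨⟨⟨fun _ => 0, rfl⟩, Subsingleton.elim _ _, fun _ _ => Subsingleton.elim _ _⟩,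
      fun _ _ => Band.mem_null_of_subsingleton _⟩, fun _ => Subsingleton.elim _ _,
      fun _ => Subsingleton.elim _ _⟩

end BandSpec

/-! ### Points of affine band schemes and their fine topology. -/

namespace BandScheme

/-- The map `X(B) → Y(B)` given by a morphism `X → Y`. -/
noncomputable def mapPoints {X Y : BandScheme.{u}} (α : X ⟶ Y) {B : BandCat.{u}}
    (x : X.Points B) : Y.Points B :=
  (show spec.obj (op B) ⟶ X from x) ≫ α

/-- The point of `Spec A` given by a morphism `A → B`. -/
noncomputable def pointOfHom {A B : BandCat.{u}} (g : BandHom A B) : (spec.obj (op A)).Points B :=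
  spec.map (show A ⟶ B from g).op

/-- The adjunction for `Z = Spec B`, combined with the identification `ρ` of the global sections
with `B`. -/
theorem pointOfHom_bijective (A B : BandCat.{u}) :
    Function.Bijective (pointOfHom : BandHom A B → (spec.obj (op A)).Points B) := by
  obtain ⟨ρ, h1, h2⟩ := BandSpec.exists_globalSections B
  constructor
  · intro f g h
    refine BandHom.ext fun a => ?_
    rw [← h1 (f a), ← h1 (g a)]
    refine (congrArg ρ (globalHom_specMap f a)).symm.trans
      (Eq.trans ?_ (congrArg ρ (globalHom_specMap g a)))
    exact congrArg (fun x => ρ (globalHom x a)) h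
  · intro f
    refine ⟨ρ.comp (globalHom (A := A) f), globalHom_injective (BandHom.ext fun a => ?_)⟩
    exact (globalHom_specMap _ a).trans (h2 _)

/-- The `B`-rational points of `Spec A` are the morphisms `A → B`. -/
noncomputable def pointsEquiv (A B : BandCat.{u}) : BandHom A B ≃ (spec.obj (op A)).Points B :=
  Equiv.ofBijective _ (pointOfHom_bijective A B)

theorem pointsEquiv_comp {A' A B : BandCat.{u}} (g : BandHom A' A) (f : BandHom A B) :
    pointsEquiv A' B (f.comp g) =
      mapPoints (spec.map (show A' ⟶ A from g).op) (pointsEquiv A B f) :=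
  spec.map_comp (show A ⟶ B from f).op (show A' ⟶ A from g).op

theorem pointsEquiv_symm_mapPoints {A' A B : BandCat.{u}} (g : BandHom A' A)
    (x : (spec.obj (op A)).Points B) :
    (pointsEquiv A' B).symm (mapPoints (spec.map (show A' ⟶ A from g).op) x) =
      ((pointsEquiv A B).symm x).comp g := by
  rw [Equiv.symm_apply_eq, pointsEquiv_comp, Equiv.apply_symm_apply]

theorem fineTopology_eq_iSup (X : BandScheme.{u}) (B : BandCat.{u}) [TopologicalSpace B] :
    fineTopology X B = ⨆ (A : BandCat.{u}) (α : spec.obj (op A) ⟶ X), TopologicalSpace.coinduced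
      (fun f : BandHom A B => mapPoints α (pointsEquiv A B f))
      (⨅ a : A, TopologicalSpace.induced (fun f : BandHom A B => f a) inferInstance) :=
  rfl

/-- The fine topology on the points of an affine band scheme is the topology of pointwise
convergence. -/
theorem fineTopology_spec (A B : BandCat.{u}) [TopologicalSpace B] :
    fineTopology (spec.obj (op A)) B = ⨅ a : A, TopologicalSpace.induced
      (fun x => (pointsEquiv A B).symm x a) inferInstance := by
  have h : (⨅ a : A, TopologicalSpace.induced
      (fun x => (pointsEquiv A B).symm x a) inferInstance) =
      TopologicalSpace.coinduced (pointsEquiv A B)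
        (⨅ a : A, TopologicalSpace.induced (fun f : BandHom A B => f a) inferInstance) := by
    rw [← Equiv.induced_symm, induced_iInf]
    refine iInf_congr fun a => ?_
    rw [induced_compose]
    rfl
  rw [h, fineTopology_eq_iSup]
  -- Every test morphism into `Spec A` is `Spec g`, and evaluation at `a` after it is evaluation at
  -- `g a`, hence continuous. Conversely, the identity of `Spec A` is one of the test morphisms.
  refine le_antisymm (iSup₂_le fun A' α => ?_) ?_
  · rw [← h]
    refine le_iInf fun a => coinduced_le_iff_le_induced.2 ?_
    obtain ⟨g, rfl⟩ : ∃ g : BandHom A A', spec.map (show A ⟶ A' from g).op = α :=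
      (pointOfHom_bijective A A').surjective α
    refine (iInf_le (fun a : A' => TopologicalSpace.induced (fun f : BandHom A' B => f a) inferInstance)
      (g a)).trans (le_of_eq ?_)
    rw [induced_compose]
    congr 1
    funext f
    rw [Function.comp_apply, pointsEquiv_symm_mapPoints, Equiv.symm_apply_apply]
    rfl
  · refine le_iSup_of_le A (le_iSup_of_le (𝟙 _) (le_of_eq ?_))
    congr 1

/-- The fine topology on `(Spec A)(B)` is initial for the maps to `(Spec Aⱼ)(B)`, if every element
of `A` comes from some `Aⱼ`. -/
theorem fineTopology_eq_iInf {J : Type u} {A : BandCat.{u}} {A' : J → BandCat.{u}}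
    (i : ∀ j, BandHom (A' j) A) (hi : ∀ a : A, ∃ (j : J) (b : A' j), i j b = a)
    (B : BandCat.{u}) [TopologicalSpace B] :
    fineTopology (spec.obj (op A)) B = ⨅ j, TopologicalSpace.induced
      (mapPoints (spec.map (show A' j ⟶ A from i j).op))
      (fineTopology (spec.obj (op (A' j))) B) := by
  have key : ∀ j : J, TopologicalSpace.induced
      (mapPoints (spec.map (show A' j ⟶ A from i j).op))
      (fineTopology (spec.obj (op (A' j))) B) = ⨅ b : A' j, TopologicalSpace.induced
        (fun x => (pointsEquiv A B).symm x (i j b)) inferInstance := by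
    intro j
    rw [fineTopology_spec, induced_iInf]
    refine iInf_congr fun b => ?_
    rw [induced_compose]
    congr 1
    funext x
    rw [Function.comp_apply, pointsEquiv_symm_mapPoints]
    rfl
  simp_rw [key]
  rw [fineTopology_spec]
  refine le_antisymm (le_iInf₂ fun j b => iInf_le _ _) (le_iInf fun a => ?_)
  obtain ⟨j, b, rfl⟩ := hi a
  exact iInf₂_le (f := fun j (b : A' j) => TopologicalSpace.induced
    (fun x => (pointsEquiv A B).symm x (i j b)) inferInstance) j b

end BandScheme

/-! ### The directed union of the monomial models -/

namespace AffineEmbedding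

/-- The embedding into `𝔸ⁿ⁺ᵐ` that adds further elements of `R` to the generators. -/
noncomputable def extend {k R : Type u} [Field k] [CommRing R] [Algebra k R]
    (ι : AffineEmbedding k R) {m : ℕ} (b : Fin m → R) : AffineEmbedding k R where
  n := ι.n + m
  pullback := MvPolynomial.aeval (Fin.append (fun i => ι.pullback (MvPolynomial.X i)) b)
  surjective r := by
    obtain ⟨p, rfl⟩ := ι.surjective r
    refine ⟨MvPolynomial.rename (Fin.castAdd m) p, ?_⟩
    rw [MvPolynomial.aeval_rename]
    have h : (Fin.append (fun i => ι.pullback (MvPolynomial.X i)) b) ∘ Fin.castAdd m =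
        fun i => ι.pullback (MvPolynomial.X i) := by
      funext i
      simp
    rw [h]
    exact DFunLike.congr_fun (MvPolynomial.aeval_unique ι.pullback).symm p

/-- The toric morphism that selects some of the coordinates. -/
noncomputable def homOfFun {k R : Type u} [Field k] [CommRing R] [Algebra k R]
    {ι j : AffineEmbedding k R} (g : Fin j.n → Fin ι.n)
    (h : ∀ i, ι.pullback (MvPolynomial.X (g i)) = j.pullback (MvPolynomial.X i)) : ι ⟶ j :=
  show Hom _ _ from
  { pullback := MvPolynomial.rename g
    isToric i := ⟨Finsupp.single (g i) 1, MvPolynomial.rename_X g i⟩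
    comp_eq := by
      refine MvPolynomial.algHom_ext fun i => ?_
      rw [AlgHom.comp_apply, MvPolynomial.rename_X, h] }

theorem extend_pullback_castAdd {k R : Type u} [Field k] [CommRing R] [Algebra k R]
    (ι : AffineEmbedding k R) {m : ℕ} (b : Fin m → R) (i : Fin ι.n) :
    (ι.extend b).pullback (MvPolynomial.X (Fin.castAdd m i)) =
      ι.pullback (MvPolynomial.X i) :=
  (MvPolynomial.aeval_X _ _).trans (Fin.append_left _ _ _)

theorem extend_pullback_natAdd {k R : Type u} [Field k] [CommRing R] [Algebra k R]
    (ι : AffineEmbedding k R) {m : ℕ} (b : Fin m → R) (i : Fin m) :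
    (ι.extend b).pullback (MvPolynomial.X (Fin.natAdd ι.n i)) = b i :=
  (MvPolynomial.aeval_X _ _).trans (Fin.append_right _ _ _)

/-- The projection to the first coordinates. -/
noncomputable def extendFst {k R : Type u} [Field k] [CommRing R] [Algebra k R]
    (ι : AffineEmbedding k R) {m : ℕ} (b : Fin m → R) : ι.extend b ⟶ ι :=
  homOfFun (ι := ι.extend b) (Fin.castAdd m) (ι.extend_pullback_castAdd b)

/-- The projection to the last coordinates. -/
noncomputable def extendSnd {k R : Type u} [Field k] [CommRing R] [Algebra k R]
    (ι j : AffineEmbedding k R) :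
    ι.extend (fun i => j.pullback (MvPolynomial.X i)) ⟶ j :=
  homOfFun (ι := ι.extend _) (Fin.natAdd ι.n) (ι.extend_pullback_natAdd _)

theorem pullback_X_mem_model {k R : Type u} [Field k] [CommRing R] [Algebra k R]
    (ι : AffineEmbedding k R) (i : Fin ι.n) : ι.pullback (MvPolynomial.X i) ∈ ι.model := by
  refine ⟨1, Pi.single i 1, ?_⟩
  rw [map_one, one_mul, Finset.prod_eq_single i] <;> simp +contextual

theorem mem_model_extend {k R : Type u} [Field k] [CommRing R] [Algebra k R]
    (ι : AffineEmbedding k R) {m : ℕ} (b : Fin m → R) (i : Fin m) :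
    b i ∈ (ι.extend b).model := by
  exact ι.extend_pullback_natAdd b i ▸ (ι.extend b).pullback_X_mem_model (Fin.natAdd ι.n i)

theorem nonempty (k R : Type u) [Field k] [CommRing R] [Algebra k R] [Algebra.FiniteType k R] :
    Nonempty (AffineEmbedding k R) := by
  obtain ⟨n, f, hf⟩ := Algebra.FiniteType.iff_quotient_mvPolynomial''.1
    (inferInstance : Algebra.FiniteType k R)
  exact ⟨⟨n, f, hf⟩⟩

/-- Finitely many elements of `R` lie in a common monomial model. -/
theorem exists_forall_mem_model (k : Type u) {R : Type u} [Field k] [CommRing R] [Algebra k R]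
    [Algebra.FiniteType k R] (s : Multiset R) :
    ∃ ι : AffineEmbedding k R, ∀ r ∈ s, r ∈ ι.model := by
  obtain ⟨ι⟩ := nonempty k R
  -- The elements of `s` become additional coordinates of an arbitrary embedding.
  refine ⟨ι.extend s.toList.get, fun r hr => ?_⟩
  obtain ⟨i, rfl⟩ := List.mem_iff_get.1 (Multiset.mem_toList.2 hr)
  exact ι.mem_model_extend _ i

end AffineEmbedding

namespace KBand

/-- An element of the monomial model. -/
def modelMk {k R : Type u} [Field k] [CommRing R] [Algebra k R] {ι : AffineEmbedding k R} (r : R)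
    (h : r ∈ ι.model) : (model ι).right :=
  ⟨r, h⟩

/-- The underlying element of `R`. -/
def modelVal {k R : Type u} [Field k] [CommRing R] [Algebra k R] (ι : AffineEmbedding k R) :
    BandHom (model ι).right (BandCat.ofCommRing R) :=
  (modelInclusion ι).right

/-- The inclusion of monomial models. -/
def modelIncl {k R : Type u} [Field k] [CommRing R] [Algebra k R] {ι j : AffineEmbedding k R}
    (f : ι ⟶ j) : BandHom (model j).right (model ι).right :=
  (modelMap f).right

theorem exists_modelVal_eq (k : Type u) {R : Type u} [Field k] [CommRing R] [Algebra k R]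
    [Algebra.FiniteType k R] (r : BandCat.ofCommRing R) :
    ∃ (ι : AffineEmbedding k R) (x : (model ι).right), modelVal ι x = r := by
  obtain ⟨ι, h⟩ := AffineEmbedding.exists_forall_mem_model k (R := R) {r}
  exact ⟨ι, modelMk r (h r (Multiset.mem_singleton_self _)), rfl⟩

/-- Compatible morphisms on the monomial models extend to a morphism on `R`. -/
theorem exists_hom_of_compatible {k R : Type u} [Field k] [CommRing R] [Algebra k R]
    [Algebra.FiniteType k R] {C : BandCat.{u}}
    (φ : ∀ ι : AffineEmbedding k R, BandHom (model ι).right C)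
    (h : ∀ (ι j : AffineEmbedding k R) (f : ι ⟶ j), (φ ι).comp (modelIncl f) = φ j) :
    ∃ ψ : BandHom (BandCat.ofCommRing R) C, ∀ ι, ψ.comp (modelVal ι) = φ ι := by
  -- Both values are computed in the embedding with the coordinates of `ι` and of `j`, where the two
  -- copies of `r` are the same element.
  have indep : ∀ (ι j : AffineEmbedding k R) (r : R) (hi : r ∈ ι.model) (hj : r ∈ j.model),
      φ ι (modelMk r hi) = φ j (modelMk r hj) := by
    intro ι j r hi hj
    rw [← h _ _ (ι.extendFst fun i => j.pullback (MvPolynomial.X i)), ← h _ _ (ι.extendSnd j)]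
    rfl
  choose e he using fun r : R => AffineEmbedding.exists_forall_mem_model k (R := R) {r}
  replace he : ∀ r : R, r ∈ (e r).model := fun r => he r r (Multiset.mem_singleton_self _)
  have val : ∀ (ι : AffineEmbedding k R) (x : (model ι).right),
      φ (e (modelVal ι x)) (modelMk _ (he (modelVal ι x))) = φ ι x :=
    fun ι x => indep _ _ _ _ x.2
  -- Any model serves to evaluate at `0` and `1`, which lie in all of them.
  obtain ⟨ι₀⟩ := AffineEmbedding.nonempty k R
  let ψ : BandHom (BandCat.ofCommRing R) C :=
    { toFun r := φ (e r) (modelMk _ (he r))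
      map_zero' := (val ι₀ 0).trans (map_zero _)
      map_one' := (val ι₀ 1).trans (map_one _)
      map_mul' r s := by
        obtain ⟨ι, hι⟩ := AffineEmbedding.exists_forall_mem_model k (R := R) {r, s}
        let x : (model ι).right := modelMk r (hι r (Multiset.mem_cons_self _ _))
        let y : (model ι).right := modelMk s (hι s
          (Multiset.mem_cons_of_mem (Multiset.mem_singleton_self _)))
        exact (val ι (x * y)).trans ((map_mul (φ ι) x y).trans
          (congrArg₂ (· * ·) (val ι x).symm (val ι y).symm))
      map_null s hs := by
        obtain ⟨ι, hι⟩ := AffineEmbedding.exists_forall_mem_model k (R := R) s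
        -- The finitely many terms of the null sum are lifted to one model; the lift is null because
        -- the null set of the model is induced from `R`.
        let t : Multiset (model ι).right := s.pmap (fun r hr => modelMk r hr) hι
        have hts : t.map (modelVal ι) = s := by
          refine (Multiset.map_pmap _ _ _ _).trans ?_
          exact (Multiset.pmap_eq_map _ (fun r => r) _ _).trans (Multiset.map_id s)
        have ht : t ∈ Band.null := by
          change t.map (modelVal ι) ∈ Band.null (B := BandCat.ofCommRing R)
          rwa [hts]
        have := (φ ι).map_mem_null ht
        rw [← hts, Multiset.map_map]
        convert! this using 1
        exact Multiset.map_congr rfl fun x _ => val ι x }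
  exact ⟨ψ, fun ι => BandHom.ext fun x => val ι x⟩

theorem hom_ext_of_models {k R : Type u} [Field k] [CommRing R] [Algebra k R]
    [Algebra.FiniteType k R] {C : BandCat.{u}} {f g : BandHom (BandCat.ofCommRing R) C}
    (h : ∀ ι : AffineEmbedding k R, f.comp (modelVal ι) = g.comp (modelVal ι)) : f = g := by
  refine BandHom.ext fun r => ?_
  obtain ⟨ι, x, rfl⟩ := exists_modelVal_eq k r
  exact DFunLike.congr_fun (h ι) x

end KBand

/-! ### The limit of the models -/

open BandScheme in
/-- Compatible morphisms to the `Y_ι` come from a unique morphism to `X`. -/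
theorem existsUnique_lift {k R : Type u} [Field k] [CommRing R] [Algebra k R]
    [Algebra.FiniteType k R] {Z : BandScheme.{u}}
    (x : ∀ ι : AffineEmbedding k R, Z ⟶ ((modelDiagram k R).obj ι).left)
    (hx : ∀ (ι j : AffineEmbedding k R) (f : ι ⟶ j),
      x ι ≫ ((modelDiagram k R).map f).left = x j) :
    ∃! y : Z ⟶ (modelCone k R).pt.left, ∀ ι, y ≫ ((modelCone k R).π.app ι).left = x ι := by
  have hcomp : ∀ (y : Z ⟶ spec.obj (op (BandCat.ofCommRing R))) (ι : AffineEmbedding k R),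
      globalHom (A := (KBand.model ι).right) (y ≫ ((modelCone k R).π.app ι).left) =
        (globalHom y).comp (KBand.modelVal ι) :=
    fun y ι => globalHom_comp_specMap (KBand.modelVal ι) y
  obtain ⟨ψ, hψ⟩ := KBand.exists_hom_of_compatible
    (fun ι => globalHom (A := (KBand.model ι).right) (x ι)) (fun ι j f =>
      (globalHom_comp_specMap (KBand.modelIncl f) (x ι)).symm.trans
        (congrArg (globalHom (A := (KBand.model j).right)) (hx ι j f)))
  obtain ⟨y, hy⟩ := globalHom_surjective (A := BandCat.ofCommRing R) ψ
  refine ⟨y, fun ι => ?_, fun y' hy' => ?_⟩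
  · refine globalHom_injective (A := (KBand.model ι).right) ((hcomp y ι).trans ?_)
    rw [hy, hψ]
  · refine globalHom_injective (A := BandCat.ofCommRing R)
      (KBand.hom_ext_of_models (k := k) fun ι => ?_)
    rw [hy, hψ]
    exact (hcomp y' ι).symm.trans (congrArg (globalHom (A := (KBand.model ι).right)) (hy' ι))

theorem nonempty_isLimit_modelCone (k R : Type u) [Field k] [CommRing R] [Algebra k R]
    [Algebra.FiniteType k R] :
    Nonempty (Limits.IsLimit ((Over.forget _).mapCone (modelCone k R))) := by
  have key := fun s : Limits.Cone (modelDiagram k R ⋙ Over.forget _) =>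
    existsUnique_lift (k := k) (R := R) (fun ι => s.π.app ι) (fun _ _ f => s.w f)
  exact ⟨{
    lift := fun s => (key s).choose
    fac := fun s => (key s).choose_spec.1
    uniq := fun s => (key s).choose_spec.2 }⟩

/-! ### Bijectivity on rational points. -/

theorem toLimPoints_bijective (k R : Type u) [Field k] [CommRing R] [Algebra k R]
    [Algebra.FiniteType k R] (B : BandCat.{u}) :
    Function.Bijective
      (BandScheme.toLimPoints ((Over.forget _).mapCone (modelCone k R)) B) := by
  refine Function.bijective_iff_existsUnique _ |>.2 fun x => ?_
  obtain ⟨y, hy, huniq⟩ := existsUnique_lift (k := k) (R := R) x.1 x.2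
  exact ⟨y, Subtype.ext (funext hy), fun y' h => huniq y' fun ι =>
    congrFun (congrArg Subtype.val h) ι⟩

theorem kToLimPoints_bijective (k R : Type u) [Field k] [CommRing R] [Algebra k R]
    [Algebra.FiniteType k R] (B : KBand k) :
    Function.Bijective (KBandScheme.toLimPoints (modelCone k R) B) := by
  refine Function.bijective_iff_existsUnique _ |>.2 fun x => ?_
  obtain ⟨y, hy, huniq⟩ := existsUnique_lift (k := k) (R := R)
    (fun ι => CommaMorphism.left (x.1 ι)) (fun ι j f => congrArg CommaMorphism.left (x.2 ι j f))
  -- The lift `y` is so far only a morphism of band schemes. The structure morphism of `X` factors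
  -- through any `Y_ι`, and `x ι` is a morphism over `k`, so one embedding suffices to show that `y`
  -- is too.
  obtain ⟨ι⟩ := AffineEmbedding.nonempty k R
  have hw : y ≫ (modelCone k R).pt.hom = B.spec.hom := by
    have h1 := Over.w ((modelCone k R).π.app ι)
    refine (congrArg (y ≫ ·) h1).symm.trans ((Category.assoc _ _ _).symm.trans ?_)
    exact (congrArg (· ≫ _) (hy ι)).trans (Over.w (x.1 ι))
  refine ⟨Over.homMk y hw, Subtype.ext (funext fun ι => Over.OverMorphism.ext (hy ι)),
    fun y' h => Over.OverMorphism.ext (huniq _ fun ι =>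
      congrArg CommaMorphism.left (congrFun (congrArg Subtype.val h) ι))⟩

/-! ### The topology on rational points. -/

theorem fineTopology_modelCone (k R : Type u) [Field k] [CommRing R] [Algebra k R]
    [Algebra.FiniteType k R] (B : BandCat.{u}) [TopologicalSpace B] :
    BandScheme.fineTopology (modelCone k R).pt.left B =
      ⨅ ι, TopologicalSpace.induced (BandScheme.mapPoints ((modelCone k R).π.app ι).left)
        (BandScheme.fineTopology ((modelDiagram k R).obj ι).left B) :=
  BandScheme.fineTopology_eq_iInf (fun ι : AffineEmbedding k R => KBand.modelVal ι)
    (KBand.exists_modelVal_eq k) B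

/-- The subspace topology of the product is the infimum of the topologies induced by the
coordinates, which is the description in `fineTopology_modelCone`. -/
theorem isInducing_toLimPoints (k R : Type u) [Field k] [CommRing R] [Algebra k R]
    [Algebra.FiniteType k R] (B : BandCat.{u}) [TopologicalSpace B] :
    Topology.IsInducing
      (BandScheme.toLimPoints ((Over.forget _).mapCone (modelCone k R)) B) := by
  refine ⟨(fineTopology_modelCone k R B).trans ?_⟩
  rw [instTopologicalSpaceSubtype, Pi.topologicalSpace, induced_compose, induced_iInf]
  simp_rw [induced_compose]
  rfl

/-- The inclusion `X_k(B) ⊆ X(B)`. -/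
noncomputable def KBandScheme.pointsLeft {k : Type u} [Field k] {X : KBandScheme k} {B : KBand k}
    (x : X.Points B) : X.left.Points B.right :=
  Over.Hom.left (show B.spec ⟶ X from x)

theorem KBandScheme.fineTopology_eq_induced {k : Type u} [Field k] (X : KBandScheme k)
    (B : KBand k) [TopologicalSpace B.right] :
    X.fineTopology B = TopologicalSpace.induced KBandScheme.pointsLeft
      (X.left.fineTopology B.right) :=
  rfl

/-- All topologies here are induced from points not required to be over `k`, and inducing commutes
with infima, so `fineTopology_modelCone` applies again. -/
theorem isInducing_kToLimPoints (k R : Type u) [Field k] [CommRing R] [Algebra k R]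
    [Algebra.FiniteType k R] (B : KBand k) [TopologicalSpace B.right] :
    Topology.IsInducing (KBandScheme.toLimPoints (modelCone k R) B) := by
  refine ⟨?_⟩
  rw [KBandScheme.fineTopology_eq_induced, fineTopology_modelCone, instTopologicalSpaceSubtype,
    Pi.topologicalSpace, induced_compose, induced_iInf, induced_iInf]
  refine iInf_congr fun ι => ?_
  rw [KBandScheme.fineTopology_eq_induced, induced_compose, induced_compose, induced_compose]
  rfl

theorem isHomeomorph_of_isInducing {S T : Type*} [TopologicalSpace S] [TopologicalSpace T]
    {f : S → T} (h : Topology.IsInducing f) (hf : Function.Bijective f) : IsHomeomorph f :=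
  (Equiv.toHomeomorphOfIsInducing (Equiv.ofBijective f hf) h).isHomeomorph

theorem theorem4p1 {k R : Type u} [Field k] [CommRing R] [Algebra k R] [Algebra.FiniteType k R] :
    Nonempty (Limits.IsLimit ((Over.forget _).mapCone (modelCone k R))) ∧
    (∀ B : KBand k,
      Function.Bijective (KBandScheme.toLimPoints (modelCone k R) B)) ∧
    (∀ (B : KBand k) [TopologicalSpace B.right] [ContinuousMul B.right],
      IsHomeomorph (KBandScheme.toLimPoints (modelCone k R) B)) ∧
    (∀ B : BandCat.{u},
      Function.Bijective (BandScheme.toLimPoints ((Over.forget _).mapCone (modelCone k R)) B)) ∧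
    (∀ (B : BandCat.{u}) [TopologicalSpace B] [ContinuousMul B],
      IsHomeomorph (BandScheme.toLimPoints ((Over.forget _).mapCone (modelCone k R)) B)) :=
  ⟨nonempty_isLimit_modelCone k R, kToLimPoints_bijective k R,
    fun B _ _ => isHomeomorph_of_isInducing (isInducing_kToLimPoints k R B)
      (kToLimPoints_bijective k R B),
    toLimPoints_bijective k R,
    fun B _ _ => isHomeomorph_of_isInducing (isInducing_toLimPoints k R B)
      (toLimPoints_bijective k R B)⟩
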